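/- Let $d\ge 1$ be an integer and let $\gamma,\beta,L,c_1>0$. For $C_1>0$ let $\mathcal H'_{\gamma}(c_1,C_1)$ be the class of probability densities $p$ on $\mathbb R^d$ with $p(x)\le C_1\exp(-c_1\|x\|^\gamma)$ for all $x$. Let $\mathcal P_{\mathcal S}(\beta,L)$ be the class of probability densities $p$ on $\mathbb R^d$ such that $$\int_{\mathbb R^d}|\omega^\alpha|^2\,|\mathcal F[p](\omega)|^2\,d\omega\le(2\pi)^dL^2,\qquad \mathcal F[p](\omega)=\int_{\mathbb R^d} p(x)e^{-i\langle\omega,x\rangle}\,dx,\qquad |\omega^\alpha|=\prod_{i=1}^d|\omega_i|^{\alpha_i},$$ for every $\alpha\in[0,\infty)^d$ with $\sum_i\alpha_i=\beta$ (for integer $\beta$ this is the same class as with $\alpha\in\mathbb N_0^d$). For a density $p_0$ and $t>0$ put $p_t=\varphi_t*p_0$ with $\varphi_t(x)=(2\pi t)^{-d/2}e^{-\|x\|^2/(2t)}$, and $s_t=\nabla\log p_t$. Call $(c_1,C_1,L)$ nondegenerate if $\mathcal H'_\gamma(c_1,C')\cap\mathcal P_{\mathcal S}(\beta,L')\ne\emptyset$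 for some $0<C'<C_1$ and $0<L'<L$. (i) Suppose that $(c_1,C_1,L)$ is nondegenerate, and let $a,T>0$. Then there are $\kappa>0$ and $N\in\mathbb N$, depending only on $d,\gamma,\beta,L,c_1,C_1,a,T$, such that for all $n\ge N$ and all $t\ge a\,n^{-2/(d+2\beta)}$ (with $t\le T$ in addition if $d=1$) $$\inf_{\hat s_t}\ \sup_{p_0\in\mathcal H'_\gamma(c_1,C_1)\cap\mathcal P_{\mathcal S}(\beta,L)}\ \mathbb E\left[\int_{\mathbb R^d}\|\hat s_t(x)-s_t(x)\|^2\,p_t(x)\,dx\right]\ \ge\ \kappa\,n^{-1}\,t^{-1-d/2},$$ where the infimum is over all measurable estimators $\hat s_t(x)=\hat s_t(x;X^{(1)},\dots,X^{(n)})$ and the expectation is over i.i.d. samples $X^{(1)},\dots,X^{(n)}$ from $p_0$. (ii) For given $d,\gamma,\beta,L,c_1$, the triple $(c_1,C_1,L)$ is nondegenerate for all sufficiently large $C_1$. -/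

import Mathlib

open MeasureTheory

noncomputable section

namespace ScoreEstimation

/-- The Fourier transform `F[f](ω) = ∫ f(x) exp(-i ⟨ω, x⟩) dx` of a real function on `ℝ^d`
(no factor `2π` in the exponent). -/
def fourierTransform {d : ℕ} (f : EuclideanSpace ℝ (Fin d) → ℝ)
    (ω : EuclideanSpace ℝ (Fin d)) : ℂ :=
  ∫ x, (f x : ℂ) * Complex.exp (-Complex.I * ((inner ℝ ω x : ℝ) : ℂ))

/-- `p` is a probability density on `ℝ^d` with respect to Lebesgue measure. -/
def IsDensity {d : ℕ} (p : EuclideanSpace ℝ (Fin d) → ℝ) : Prop :=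
  Integrable p ∧ (∀ x, 0 ≤ p x) ∧ ∫ x, p x = 1

/-- Densities with stretched-exponential tails: `p(x) ≤ C exp(-c ‖x‖^γ)`. -/
def expTailClass (d : ℕ) (γ c C : ℝ) : Set (EuclideanSpace ℝ (Fin d) → ℝ) :=
  {p | IsDensity p ∧ ∀ x, p x ≤ C * Real.exp (-c * ‖x‖ ^ γ)}

/-- The Sobolev class of densities with smoothness `β > 0` and radius `L`: for every multi-index
`α` with `∑ α_i = β`, `∫ |ω^α|² |F[p](ω)|² dω ≤ (2π)^d L²`.

The multi-indices have nonnegative real entries and `|ω^α| = ∏ |ω_i|^{α_i}`, so that the condition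
is meaningful for every real `β > 0`. For an integer `β ≥ 1` this is the same class as with integer
multi-indices: the weighted inequality `∏ |ω_i|^{2 α_i} ≤ ∑ (α_i / β) |ω_i|^{2β}` reduces every
`α` to the multi-indices `β e_i`. -/
def sobolevClass (d : ℕ) (β L : ℝ) : Set (EuclideanSpace ℝ (Fin d) → ℝ) :=
  {p | IsDensity p ∧ ∀ α : Fin d → ℝ, (∀ i, 0 ≤ α i) → ∑ i, α i = β →
    ∫⁻ ω : EuclideanSpace ℝ (Fin d),
      ENNReal.ofReal ((∏ i, |ω i| ^ α i) ^ 2 * ‖fourierTransform p ω‖ ^ 2)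
      ≤ ENNReal.ofReal ((2 * Real.pi) ^ d * L ^ 2)}

/-- The Gaussian density `φ_t(x) = (2πt)^{-d/2} exp(-‖x‖² / (2t))` of variance `t`. -/
def gaussianKernel {d : ℕ} (t : ℝ) (x : EuclideanSpace ℝ (Fin d)) : ℝ :=
  (2 * Real.pi * t) ^ (-(d : ℝ) / 2) * Real.exp (-‖x‖ ^ 2 / (2 * t))

/-- The density `p_t = φ_t * p` of `X₀ + √t Z`, with `X₀ ∼ p` and an independent standard
Gaussian `Z`. -/
def diffusedDensity {d : ℕ} (p : EuclideanSpace ℝ (Fin d) → ℝ) (t : ℝ)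
    (x : EuclideanSpace ℝ (Fin d)) : ℝ :=
  ∫ y, gaussianKernel t (x - y) * p y

/-- The score `s_t = ∇ log p_t`. -/
def score {d : ℕ} (p : EuclideanSpace ℝ (Fin d) → ℝ) (t : ℝ)
    (x : EuclideanSpace ℝ (Fin d)) : EuclideanSpace ℝ (Fin d) :=
  gradient (fun y => Real.log (diffusedDensity p t y)) x

/-- The law on `ℝ^d` with density `p`. -/
def densityMeasure {d : ℕ} (p : EuclideanSpace ℝ (Fin d) → ℝ) :
    Measure (EuclideanSpace ℝ (Fin d)) :=
  volume.withDensity fun x => ENNReal.ofReal (p x)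

/-- The risk `E ∫ ‖ŝ(x) - s_t(x)‖² p_t(x) dx` of an estimator `ŝ` of the score at time `t`, which
is computed from `n` independent samples of `p`. -/
def scoreRisk {d n : ℕ}
    (shat : (Fin n → EuclideanSpace ℝ (Fin d)) →
      EuclideanSpace ℝ (Fin d) → EuclideanSpace ℝ (Fin d))
    (p : EuclideanSpace ℝ (Fin d) → ℝ) (t : ℝ) : ENNReal :=
  ∫⁻ X, (∫⁻ x, ‖shat X x - score p t x‖ₑ ^ 2 * ENNReal.ofReal (diffusedDensity p t x))
    ∂(Measure.pi fun _ : Fin n => densityMeasure p)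

/-- The minimax risk over the class `P`: the infimum over all (jointly measurable) estimators based
on `n` samples of the supremum over `p ∈ P` of the risk at time `t`. -/
def minimaxScoreRisk {d : ℕ} (P : Set (EuclideanSpace ℝ (Fin d) → ℝ)) (n : ℕ) (t : ℝ) : ENNReal :=
  ⨅ (shat : (Fin n → EuclideanSpace ℝ (Fin d)) →
      EuclideanSpace ℝ (Fin d) → EuclideanSpace ℝ (Fin d))
    (_ : Measurable (Function.uncurry shat)),
    ⨆ p ∈ P, scoreRisk shat p t

/-- The constants of the class `expTailClass d γ c C ∩ sobolevClass d β L` are nondegenerate: the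
class stays nonempty when `C` and `L` are decreased slightly. (For critical or smaller values of
`C` or `L` the class is empty, or may be a single density, and there is nothing to estimate.) -/
def Nondegenerate (d : ℕ) (γ c C β L : ℝ) : Prop :=
  ∃ C' L' : ℝ, 0 < C' ∧ C' < C ∧ 0 < L' ∧ L' < L ∧
    (expTailClass d γ c C' ∩ sobolevClass d β L').Nonempty

end ScoreEstimation

end

/-! Assouad's lemma is applied to a hypercube of perturbations of one density. Nondegeneracy leaves
room to mix in a smooth bump density, so the class contains, with slack in both constants, a base
density `p ≥ m > 0` on a ball of radius comparable to `√T` (`Nondegenerate.exists_base`). The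
hypotheses are `p + A ∑ ε_k ψ(h⁻¹ y - z_k)` with `ε_k ∈ {0, 1}`, where `ψ` is an odd bump, `h =
√(min t T)`, the `z_k` form a grid of `M^d` points with `M h` comparable to `√T`, and `A²` is a
small multiple of `1 / (n h^d)`.

Flipping one `ε_k` costs a chi-square divergence of order `A² h^d`, hence at most `1/n`, so `n`
samples cannot detect it (`le_lintegral_add_lintegral`). The supports are disjoint, so the Sobolev
energy of the whole sum is of order `A² M^d h^(d-2β)`, that is `n⁻¹ h^(-d-2β)`
(`exists_sobolev_bound`). This stays bounded exactly because `t ≥ a n^(-2/(d+2β))`.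

After Gaussian smoothing a bump is positive near `h z + √t e` and, by oddness, negative near `h z -
√t e`. The log-ratio of two neighbouring densities therefore changes by a definite amount over a
distance `2√t`, which forces its gradient, the difference of the scores, to be large in `L²` on a
ball of radius `3√t` (`le_lintegral_score_sub`). Weighted by the lower bound for `p_t` there, each
cell contributes order `A² h^(d+2) / t²`. Summing over about `h^(-d)` cells gives `n⁻¹ h^(2-d) t⁻²`.
This is `n⁻¹ t^(-1-d/2)` when `h = √t`, and at least that when `h ≤ √t` and `d ≥ 2`; for `d = 1` one
needs `t ≤ T`.

Part (ii) dilates a compactly supported smooth density until its Sobolev energy is small. -/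

noncomputable section

namespace ScoreEstimation

/-! ### Sobolev energy of sums of disjoint, rescaled bumps. -/

section Fourier

open scoped FourierTransform SchwartzMap Laplacian ContDiff

variable {E : Type*} [NormedAddCommGroup E] [InnerProductSpace ℝ E] [FiniteDimensional ℝ E]

theorem tsupport_laplacian_subset (f : 𝓢(E, ℂ)) : tsupport (Δ f : 𝓢(E, ℂ)) ⊆ tsupport f := by
  rw [SchwartzMap.laplacian_eq_sum (stdOrthonormalBasis ℝ E)]
  refine closure_minimal (fun x hx => ?_) (isClosed_tsupport _)
  by_contra hxf
  apply hx
  rw [sum_apply]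
  refine Finset.sum_eq_zero fun i _ => ?_
  have h := (SchwartzMap.tsupport_lineDerivOp_subset (stdOrthonormalBasis ℝ E i)
    (LineDeriv.lineDerivOp (stdOrthonormalBasis ℝ E i) f)).trans
    (SchwartzMap.tsupport_lineDerivOp_subset (stdOrthonormalBasis ℝ E i) f)
  exact image_eq_zero_of_notMem_tsupport fun hx' => hxf (h hx')

theorem tsupport_laplacian_iterate_subset (j : ℕ) (f : 𝓢(E, ℂ)) :
    tsupport (Δ^[j] f : 𝓢(E, ℂ)) ⊆ tsupport f := by
  induction j with
  | zero => simp
  | succ j ih =>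
    rw [Function.iterate_succ_apply']
    exact (tsupport_laplacian_subset _).trans ih

theorem laplacian_iterate_sum {ι : Type*} (s : Finset ι) (j : ℕ) (f : ι → 𝓢(E, ℂ)) :
    Δ^[j] (∑ i ∈ s, f i) = ∑ i ∈ s, Δ^[j] (f i) := by
  induction j with
  | zero => simp
  | succ j ih =>
    simp only [Function.iterate_succ_apply', ih]
    exact map_sum (LineDeriv.laplacianCLM ℝ E 𝓢(E, ℂ)) _ _

variable [MeasurableSpace E] [BorelSpace E]

theorem fourier_laplacian_apply (f : 𝓢(E, ℂ)) (ξ : E) :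
    𝓕 (Δ f) ξ = -((2 * Real.pi * ‖ξ‖) ^ 2 : ℝ) * 𝓕 f ξ := by
  have hg : (fun x : E => ‖x‖ ^ 2).HasTemperateGrowth := by fun_prop
  rw [SchwartzMap.laplacian_eq_fourierMultiplierCLM, SchwartzMap.fourierMultiplierCLM_apply,
    FourierTransform.fourier_smul, FourierTransform.fourier_fourierInv_eq]
  simp only [smul_apply]
  erw [SchwartzMap.smulLeftCLM_apply_apply hg]
  simp
  ring

theorem fourier_laplacian_iterate_apply (j : ℕ) (f : 𝓢(E, ℂ)) (ξ : E) :
    𝓕 (Δ^[j] f) ξ = (-((2 * Real.pi * ‖ξ‖) ^ 2 : ℝ) : ℂ) ^ j * 𝓕 f ξ := by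
  induction j with
  | zero => simp
  | succ j ih =>
    rw [Function.iterate_succ_apply', fourier_laplacian_apply, ih]
    ring

/-- The squared Sobolev norm of order `2j`. -/
def sobolevNormSq (j : ℕ) (f : 𝓢(E, ℂ)) : ℝ :=
  ∫ ξ, (1 + (2 * Real.pi * ‖ξ‖) ^ (4 * j)) * ‖𝓕 f ξ‖ ^ 2

theorem integrable_norm_sq_schwartz (f : 𝓢(E, ℂ)) : Integrable fun x => ‖f x‖ ^ 2 :=
  (memLp_two_iff_integrable_sq_norm (f.memLp 2).1).1 (f.memLp 2)

theorem sobolev_weight_eq (j : ℕ) (f : 𝓢(E, ℂ)) (ξ : E) :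
    (1 + (2 * Real.pi * ‖ξ‖) ^ (4 * j)) * ‖𝓕 f ξ‖ ^ 2
      = ‖𝓕 f ξ‖ ^ 2 + ‖𝓕 (Δ^[j] f) ξ‖ ^ 2 := by
  rw [fourier_laplacian_iterate_apply, norm_mul, norm_pow, norm_neg, Complex.norm_real,
    Real.norm_of_nonneg (by positivity)]
  generalize 2 * Real.pi * ‖ξ‖ = a
  ring

theorem integrable_sobolev_weight (j : ℕ) (f : 𝓢(E, ℂ)) :
    Integrable fun ξ => (1 + (2 * Real.pi * ‖ξ‖) ^ (4 * j)) * ‖𝓕 f ξ‖ ^ 2 := by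
  simp_rw [sobolev_weight_eq]
  exact (integrable_norm_sq_schwartz _).add (integrable_norm_sq_schwartz _)

theorem sobolevNormSq_eq (j : ℕ) (f : 𝓢(E, ℂ)) :
    sobolevNormSq j f = ∫ x, (‖f x‖ ^ 2 + ‖(Δ^[j] f) x‖ ^ 2) := by
  unfold sobolevNormSq
  simp_rw [sobolev_weight_eq]
  rw [integral_add (integrable_norm_sq_schwartz _) (integrable_norm_sq_schwartz _),
    integral_add (integrable_norm_sq_schwartz _) (integrable_norm_sq_schwartz _),
    SchwartzMap.integral_norm_sq_fourier, SchwartzMap.integral_norm_sq_fourier]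

theorem norm_sq_sum_of_disjoint {ι : Type*} (s : Finset ι) (z : ι → ℂ)
    (hz : ∀ i ∈ s, ∀ k ∈ s, i ≠ k → z i = 0 ∨ z k = 0) :
    ‖∑ i ∈ s, z i‖ ^ 2 = ∑ i ∈ s, ‖z i‖ ^ 2 := by
  by_cases h : ∃ i ∈ s, z i ≠ 0
  · obtain ⟨i, hi, hzi⟩ := h
    have h0 : ∀ k ∈ s, k ≠ i → z k = 0 := fun k hk hki =>
      (hz i hi k hk hki.symm).resolve_left hzi
    rw [Finset.sum_eq_single_of_mem i hi h0,
      Finset.sum_eq_single_of_mem i hi fun k hk hki => by simp [h0 k hk hki]]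
  · push Not at h
    rw [Finset.sum_eq_zero h, Finset.sum_eq_zero fun i hi => by simp [h i hi]]
    simp

/-- Plancherel turns the norm into an integral of `‖f‖² + ‖Δ^j f‖²`, and differential operators do
not enlarge supports. Fractional orders are not local in this way, which is why an even integer
order `2j` is used. -/
theorem sobolevNormSq_sum {ι : Type*} (s : Finset ι) (j : ℕ) (f : ι → 𝓢(E, ℂ))
    (hf : ∀ i ∈ s, ∀ k ∈ s, i ≠ k → Disjoint (tsupport (f i)) (tsupport (f k))) :
    sobolevNormSq j (∑ i ∈ s, f i) = ∑ i ∈ s, sobolevNormSq j (f i) := by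
  simp_rw [sobolevNormSq_eq]
  rw [← integral_finsetSum s (f := fun i x => ‖f i x‖ ^ 2 + ‖(Δ^[j] (f i)) x‖ ^ 2) fun i _ =>
    (integrable_norm_sq_schwartz _).add (integrable_norm_sq_schwartz _)]
  congr 1
  ext x
  rw [laplacian_iterate_sum, sum_apply, sum_apply,
    norm_sq_sum_of_disjoint, norm_sq_sum_of_disjoint, Finset.sum_add_distrib]
  · intro i hi k hk hik
    by_contra! h
    exact (hf i hi k hk hik).le_bot
      ⟨tsupport_laplacian_iterate_subset j _ (subset_tsupport _ h.1),
        tsupport_laplacian_iterate_subset j _ (subset_tsupport _ h.2)⟩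
  · intro i hi k hk hik
    by_contra! h
    exact (hf i hi k hk hik).le_bot ⟨subset_tsupport _ h.1, subset_tsupport _ h.2⟩

theorem norm_fourier_comp_sub (f : E → ℂ) (z ξ : E) :
    ‖𝓕 (fun x => f (x - z)) ξ‖ = ‖𝓕 f ξ‖ := by
  have h : 𝓕 (fun x => f (x - z)) ξ
      = Real.fourierChar (-(inner ℝ z ξ)) • 𝓕 f ξ := by
    rw [Real.fourier_eq, Real.fourier_eq, ← integral_add_right_eq_self _ z]
    rw [Circle.smul_def, ← integral_smul]
    congr 1
    ext x
    simp only [add_sub_cancel_right, inner_add_left, neg_add, AddChar.map_add_eq_mul,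
      Circle.smul_def, Circle.coe_mul, smul_eq_mul]
    ring
  rw [h, Circle.norm_smul]

theorem fourierTransform_eq {d : ℕ} (p : EuclideanSpace ℝ (Fin d) → ℝ)
    (w : EuclideanSpace ℝ (Fin d)) :
    fourierTransform p w = 𝓕 (fun x => (p x : ℂ)) ((2 * Real.pi)⁻¹ • w) := by
  rw [fourierTransform, Real.fourier_eq]
  congr 1
  ext x
  rw [Circle.smul_def, Real.fourierChar_apply, smul_eq_mul, mul_comm, real_inner_comm,
    inner_smul_right]
  congr 2
  push_cast
  have : (Real.pi : ℂ) ≠ 0 := by exact_mod_cast Real.pi_ne_zero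
  field_simp

theorem fourierTransform_comp_smul {d : ℕ} (p : EuclideanSpace ℝ (Fin d) → ℝ) {h : ℝ}
    (hh : 0 < h) (w : EuclideanSpace ℝ (Fin d)) :
    fourierTransform (fun y => p (h⁻¹ • y)) w = (h ^ d : ℝ) * fourierTransform p (h • w) := by
  have key := Measure.integral_comp_smul (volume : Measure (EuclideanSpace ℝ (Fin d)))
    (fun x => (p x : ℂ) * Complex.exp (-Complex.I * ((inner ℝ (h • w) x : ℝ) : ℂ))) h⁻¹
  simp only [fourierTransform]
  rw [finrank_euclideanSpace_fin, inv_pow, inv_inv, abs_of_pos (by positivity)] at key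
  rw [← Complex.real_smul, ← key]
  congr 1
  ext x
  rw [inner_smul_left, inner_smul_right]
  simp [hh.ne']

/-- After rescaling to unit width, the weight of order `β` is dominated by the weight of order `2j ≥
β`, whose norm is additive over the disjoint bumps. Translation does not change the modulus of a
Fourier transform, so all bumps contribute equally up to the factors `σ i`. Undoing the dilation
gives the power of `h`. -/
theorem exists_sobolev_bound {d : ℕ} {β : ℝ} (hβ : 0 < β) {f : EuclideanSpace ℝ (Fin d) → ℝ}
    (hf : ContDiff ℝ ∞ f) (hc : HasCompactSupport f) {r : ℝ}
    (hr : tsupport f ⊆ Metric.closedBall 0 r) :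
    ∃ C : ℝ, 0 < C ∧ ∀ (ι : Type) (s : Finset ι) (z : ι → EuclideanSpace ℝ (Fin d)) (σ : ι → ℝ)
      (h : ℝ), 0 < h → (∀ i ∈ s, ∀ k ∈ s, i ≠ k → 2 * r < dist (z i) (z k)) →
      (∀ i ∈ s, |σ i| ≤ 1) →
      ∫⁻ w, ENNReal.ofReal (‖w‖ ^ (2 * β) *
          ‖fourierTransform (fun y => ∑ i ∈ s, σ i * f (h⁻¹ • y - z i)) w‖ ^ 2)
        ≤ ENNReal.ofReal (C * s.card * h ^ ((d : ℝ) - 2 * β)) := by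
  obtain ⟨j, hj⟩ := exists_nat_ge β
  let F : EuclideanSpace ℝ (Fin d) → ℝ → EuclideanSpace ℝ (Fin d) → ℂ :=
    fun z σ x => ((σ * f (x - z) : ℝ) : ℂ)
  have hFs : ∀ z σ, ContDiff ℝ ∞ (F z σ) := fun z σ =>
    Complex.ofRealCLM.contDiff.comp (contDiff_const.mul (hf.comp (contDiff_id.sub contDiff_const)))
  have hft : ∀ z : EuclideanSpace ℝ (Fin d), HasCompactSupport fun x => f (x - z) := fun z => by
    simpa [sub_eq_add_neg, Function.comp_def] using hc.comp_homeomorph (Homeomorph.addRight (-z))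
  have hFc : ∀ z σ, HasCompactSupport (F z σ) := fun z σ =>
    ((hft z).mul_left (f := fun _ => σ)).comp_left (g := ((↑) : ℝ → ℂ)) rfl
  let Φ : EuclideanSpace ℝ (Fin d) → ℝ → 𝓢(EuclideanSpace ℝ (Fin d), ℂ) :=
    fun z σ => (hFc z σ).toSchwartzMap (hFs z σ)
  have hΦ : ∀ z σ x, Φ z σ x = ((σ * f (x - z) : ℝ) : ℂ) := fun _ _ _ => rfl
  have hΦF : ∀ z σ ξ, ‖𝓕 (Φ z σ) ξ‖ = |σ| * ‖𝓕 (Φ 0 1) ξ‖ := by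
    intro z σ ξ
    rw [SchwartzMap.fourier_coe, SchwartzMap.fourier_coe]
    have e1 : (Φ z σ : EuclideanSpace ℝ (Fin d) → ℂ) = fun x => (σ • (Φ 0 1 : _ → ℂ)) (x - z) := by
      ext x
      simp [hΦ]
    rw [e1, norm_fourier_comp_sub (σ • (Φ 0 1 : _ → ℂ)) z ξ]
    have e2 : 𝓕 (σ • (Φ 0 1 : EuclideanSpace ℝ (Fin d) → ℂ)) ξ
        = σ • 𝓕 (Φ 0 1 : EuclideanSpace ℝ (Fin d) → ℂ) ξ := by
      rw [Real.fourier_eq, Real.fourier_eq, ← integral_smul]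
      congr 1
      ext x
      rw [Pi.smul_apply, smul_comm]
    rw [e2, norm_smul, Real.norm_eq_abs]
  have hsupp : ∀ z σ, tsupport (Φ z σ) ⊆ Metric.closedBall z r := by
    intro z σ
    refine closure_minimal (fun x hx => ?_) Metric.isClosed_closedBall
    have hx' : f (x - z) ≠ 0 := by
      intro h0
      apply hx
      rw [hΦ, h0]
      simp
    have := hr (subset_tsupport _ hx')
    simpa [dist_eq_norm] using this
  have hN0 : 0 ≤ sobolevNormSq j (Φ 0 1) := integral_nonneg fun ξ => by positivity
  refine ⟨(2 * Real.pi) ^ (2 * β + d) * sobolevNormSq j (Φ 0 1) + 1, by positivity, ?_⟩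
  intro ι s z σ h hh hz hσ
  set φ : 𝓢(EuclideanSpace ℝ (Fin d), ℂ) := ∑ i ∈ s, Φ (z i) (σ i) with hφ
  have hnorm : sobolevNormSq j φ ≤ s.card * sobolevNormSq j (Φ 0 1) := by
    rw [hφ, sobolevNormSq_sum]
    · rw [← nsmul_eq_mul]
      refine Finset.sum_le_card_nsmul _ _ _ fun i hi => ?_
      refine integral_mono (integrable_sobolev_weight _ _) (integrable_sobolev_weight _ _)
        fun ξ => ?_
      simp only
      rw [hΦF]
      gcongr
      calc |σ i| * ‖𝓕 (Φ 0 1) ξ‖ ≤ 1 * ‖𝓕 (Φ 0 1) ξ‖ := by gcongr; exact hσ i hi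
        _ = _ := one_mul _
    · intro i hi k hk hik
      refine Disjoint.mono (hsupp _ _) (hsupp _ _) ?_
      refine Metric.closedBall_disjoint_closedBall ?_
      linarith [hz i hi k hk hik]
  -- Frequencies are rescaled by `h` for the dilation and by `1 / (2π)` for the other normalisation
  -- of the Fourier transform.
  have hc0 : 0 < h / (2 * Real.pi) := by positivity
  set c := h / (2 * Real.pi) with hcdef
  have hFT : ∀ w, fourierTransform (fun y => ∑ i ∈ s, σ i * f (h⁻¹ • y - z i)) w
      = (h ^ d : ℝ) * 𝓕 φ (c • w) := by
    intro w
    rw [fourierTransform_comp_smul (fun x => ∑ i ∈ s, σ i * f (x - z i)) hh,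
      fourierTransform_eq, SchwartzMap.fourier_coe, smul_smul]
    have e1 : (fun x => ((∑ i ∈ s, σ i * f (x - z i) : ℝ) : ℂ)) = φ := by
      ext x
      rw [hφ, sum_apply]
      simp [hΦ]
    have e2 : (2 * Real.pi)⁻¹ * h = c := by rw [hcdef]; field_simp
    rw [e1, e2]
  let H : EuclideanSpace ℝ (Fin d) → ℝ :=
    fun ξ => (1 + (2 * Real.pi * ‖ξ‖) ^ (4 * j)) * ‖𝓕 φ ξ‖ ^ 2
  have hH : Integrable H := integrable_sobolev_weight _ _
  have hpt : ∀ w, ‖w‖ ^ (2 * β) *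
      ‖fourierTransform (fun y => ∑ i ∈ s, σ i * f (h⁻¹ • y - z i)) w‖ ^ 2
      ≤ (c⁻¹ ^ (2 * β) * (h ^ d) ^ 2) * H (c • w) := by
    intro w
    have hw : ‖c • w‖ ^ (2 * β) ≤ 1 + (2 * Real.pi * ‖c • w‖) ^ (4 * j) := by
      have h1 : ‖c • w‖ ≤ 2 * Real.pi * ‖c • w‖ := by
        nlinarith [Real.pi_gt_three, norm_nonneg (c • w)]
      rcases le_total ‖c • w‖ 1 with h2 | h2
      · have : ‖c • w‖ ^ (2 * β) ≤ 1 := Real.rpow_le_one (norm_nonneg _) h2 (by positivity)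
        have h3 : 0 ≤ (2 * Real.pi * ‖c • w‖) ^ (4 * j) := by positivity
        linarith
      · calc ‖c • w‖ ^ (2 * β) ≤ ‖c • w‖ ^ ((4 * j : ℕ) : ℝ) := by
              apply Real.rpow_le_rpow_of_exponent_le h2
              push_cast
              nlinarith [(Nat.cast_nonneg j : (0 : ℝ) ≤ j)]
          _ = ‖c • w‖ ^ (4 * j) := Real.rpow_natCast _ _
          _ ≤ (2 * Real.pi * ‖c • w‖) ^ (4 * j) := by gcongr
          _ ≤ _ := by linarith
    have e : ‖w‖ = c⁻¹ * ‖c • w‖ := by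
      rw [norm_smul, Real.norm_of_nonneg hc0.le]; field_simp
    rw [hFT, norm_mul, Complex.norm_real, Real.norm_of_nonneg (by positivity), mul_pow, e,
      Real.mul_rpow (by positivity) (norm_nonneg _)]
    calc _ = (c⁻¹ ^ (2 * β) * (h ^ d) ^ 2) * (‖c • w‖ ^ (2 * β) * ‖𝓕 φ (c • w)‖ ^ 2) := by ring
      _ ≤ _ := by
        simp only [H]
        gcongr
  calc _ ≤ ∫⁻ w, ENNReal.ofReal ((c⁻¹ ^ (2 * β) * (h ^ d) ^ 2) * H (c • w)) :=
        lintegral_mono fun w => ENNReal.ofReal_le_ofReal (hpt w)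
    _ = ENNReal.ofReal (∫ w, (c⁻¹ ^ (2 * β) * (h ^ d) ^ 2) * H (c • w)) := by
        rw [ofReal_integral_eq_lintegral_ofReal]
        · exact (hH.comp_smul hc0.ne').const_mul _
        · exact Filter.Eventually.of_forall fun w => by simp only [H]; positivity
    _ ≤ _ := by
        apply ENNReal.ofReal_le_ofReal
        rw [integral_const_mul, Measure.integral_comp_smul, finrank_euclideanSpace_fin,
          abs_of_pos (by positivity), smul_eq_mul]
        change _ * (_ * sobolevNormSq j φ) ≤ _
        calc c⁻¹ ^ (2 * β) * (h ^ d) ^ 2 * ((c ^ d)⁻¹ * sobolevNormSq j φ)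
            ≤ c⁻¹ ^ (2 * β) * (h ^ d) ^ 2 * ((c ^ d)⁻¹ * (s.card * sobolevNormSq j (Φ 0 1))) := by
              gcongr
          _ = (2 * Real.pi) ^ (2 * β + d) * sobolevNormSq j (Φ 0 1) * s.card
                * h ^ ((d : ℝ) - 2 * β) := by
              have e1 : c⁻¹ = 2 * Real.pi / h := by rw [hcdef, inv_div]
              rw [← inv_pow, e1, Real.div_rpow (by positivity) hh.le, div_pow,
                Real.rpow_add (by positivity), Real.rpow_sub hh, Real.rpow_natCast,
                Real.rpow_natCast]
              field_simp
          _ ≤ _ := by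
              gcongr
              linarith

end Fourier

/-! ### The Gaussian kernel and the diffused density: smoothness and bounds. -/

section Gaussian

variable {d : ℕ}

theorem gaussianKernel_pos {t : ℝ} (ht : 0 < t) (x : EuclideanSpace ℝ (Fin d)) :
    0 < gaussianKernel t x := by
  unfold gaussianKernel; positivity

theorem contDiff_gaussianKernel {t : ℝ} {n : WithTop ℕ∞} :
    ContDiff ℝ n (gaussianKernel t : EuclideanSpace ℝ (Fin d) → ℝ) := by
  unfold gaussianKernel
  exact contDiff_const.mul (((contDiff_norm_sq ℝ).neg.div_const _).exp)

theorem continuous_gaussianKernel {t : ℝ} :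
    Continuous (gaussianKernel t : EuclideanSpace ℝ (Fin d) → ℝ) :=
  (contDiff_gaussianKernel (n := 0)).continuous

theorem gaussianKernel_le {t : ℝ} (ht : 0 < t) (x : EuclideanSpace ℝ (Fin d)) :
    gaussianKernel t x ≤ (2 * Real.pi * t) ^ (-(d : ℝ) / 2) := by
  unfold gaussianKernel
  refine mul_le_of_le_one_right (by positivity) (Real.exp_le_one_iff.2 ?_)
  rw [neg_div]
  exact neg_nonpos.2 (by positivity)

theorem le_gaussianKernel {t : ℝ} (ht : 0 < t) {x : EuclideanSpace ℝ (Fin d)} {a : ℝ}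
    (ha : ‖x‖ ^ 2 ≤ 2 * t * a) :
    (2 * Real.pi * t) ^ (-(d : ℝ) / 2) * Real.exp (-a) ≤ gaussianKernel t x := by
  unfold gaussianKernel
  gcongr
  rw [neg_div, neg_le_neg_iff, div_le_iff₀ (by positivity)]
  linarith

theorem integrable_gaussianKernel {t : ℝ} (ht : 0 < t) :
    Integrable (gaussianKernel t : EuclideanSpace ℝ (Fin d) → ℝ) := by
  have h := GaussianFourier.integrable_cexp_neg_mul_sq_norm_add (b := ((1 / (2 * t) : ℝ) : ℂ))
    (V := EuclideanSpace ℝ (Fin d)) (by rw [Complex.ofReal_re]; positivity) 0 0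
  refine (h.re.const_mul ((2 * Real.pi * t) ^ (-(d : ℝ) / 2))).congr
    (Filter.Eventually.of_forall fun x => ?_)
  simp only [gaussianKernel]
  congr 1
  have : (-((1 / (2 * t) : ℝ) : ℂ) * (‖x‖ : ℂ) ^ 2 + 0 * (inner ℝ (0 : EuclideanSpace ℝ (Fin d)) x : ℂ))
      = ((-‖x‖ ^ 2 / (2 * t) : ℝ) : ℂ) := by
    push_cast; ring
  rw [this, ← Complex.ofReal_exp]
  rfl

theorem integral_gaussianKernel {t : ℝ} (ht : 0 < t) :
    ∫ x : EuclideanSpace ℝ (Fin d), gaussianKernel t x = 1 := by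
  have h := GaussianFourier.integral_rexp_neg_mul_sq_norm (b := 1 / (2 * t))
    (V := EuclideanSpace ℝ (Fin d)) (by positivity)
  simp only [gaussianKernel]
  rw [integral_const_mul]
  have e : ∀ x : EuclideanSpace ℝ (Fin d), -‖x‖ ^ 2 / (2 * t) = -(1 / (2 * t)) * ‖x‖ ^ 2 := by
    intro x; ring
  simp_rw [e, h, finrank_euclideanSpace_fin]
  rw [div_div_eq_mul_div, div_one, show Real.pi * (2 * t) = 2 * Real.pi * t by ring, neg_div,
    Real.rpow_neg (by positivity)]
  exact inv_mul_cancel₀ (by positivity)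

theorem hasFDerivAt_gaussianKernel (t : ℝ) (x : EuclideanSpace ℝ (Fin d)) :
    HasFDerivAt (gaussianKernel t) ((-(gaussianKernel t x / t)) • innerSL ℝ x) x := by
  unfold gaussianKernel
  have h1 : HasFDerivAt (fun x : EuclideanSpace ℝ (Fin d) => -‖x‖ ^ 2 / (2 * t))
      ((2 * t)⁻¹ • -(2 • innerSL ℝ x : EuclideanSpace ℝ (Fin d) →L[ℝ] ℝ)) x := by
    simpa [div_eq_inv_mul] using ((hasStrictFDerivAt_norm_sq x).hasFDerivAt.neg.const_mul (2 * t)⁻¹)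
  refine (h1.exp.const_mul ((2 * Real.pi * t) ^ (-(d : ℝ) / 2))).congr_fderiv ?_
  ext v
  simp
  field_simp

theorem exists_norm_fderiv_gaussianKernel_le {t : ℝ} (ht : 0 < t) :
    ∃ K : ℝ, ∀ x : EuclideanSpace ℝ (Fin d), ‖fderiv ℝ (gaussianKernel t) x‖ ≤ K := by
  refine ⟨(2 * Real.pi * t) ^ (-(d : ℝ) / 2) / t * (1 + 2 * t), fun x => ?_⟩
  rw [(hasFDerivAt_gaussianKernel t x).fderiv, norm_smul, innerSL_apply_norm, Real.norm_eq_abs,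
    abs_neg, abs_of_pos (div_pos (gaussianKernel_pos ht x) ht)]
  -- Since `exp u ≥ 1 + u`, the right side is at least `1 + ‖x‖²`, which dominates `‖x‖`.
  have h1 : ‖x‖ ≤ (1 + 2 * t) * Real.exp (‖x‖ ^ 2 / (2 * t)) := by
    have h2 := Real.add_one_le_exp (‖x‖ ^ 2 / (2 * t))
    have h3 : (1 + 2 * t) * (‖x‖ ^ 2 / (2 * t) + 1)
        = ‖x‖ ^ 2 / (2 * t) + 1 + ‖x‖ ^ 2 + 2 * t := by field_simp; ring
    have h4 : 0 ≤ ‖x‖ ^ 2 / (2 * t) := by positivity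
    nlinarith [sq_nonneg (‖x‖ - 1)]
  have h2 : gaussianKernel t x * Real.exp (‖x‖ ^ 2 / (2 * t))
      = (2 * Real.pi * t) ^ (-(d : ℝ) / 2) := by
    unfold gaussianKernel
    rw [mul_assoc, ← Real.exp_add, ← add_div, neg_add_cancel, zero_div, Real.exp_zero, mul_one]
  calc gaussianKernel t x / t * ‖x‖
      ≤ gaussianKernel t x / t * ((1 + 2 * t) * Real.exp (‖x‖ ^ 2 / (2 * t))) := by
        have := gaussianKernel_pos ht x
        gcongr
    _ = gaussianKernel t x * Real.exp (‖x‖ ^ 2 / (2 * t)) / t * (1 + 2 * t) := by ring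
    _ = _ := by rw [h2]

theorem integrable_gaussianKernel_mul {t : ℝ} (ht : 0 < t) {p : EuclideanSpace ℝ (Fin d) → ℝ}
    (hp : Integrable p) (x : EuclideanSpace ℝ (Fin d)) :
    Integrable fun y => gaussianKernel t (x - y) * p y := by
  refine hp.bdd_mul (c := (2 * Real.pi * t) ^ (-(d : ℝ) / 2))
    (continuous_gaussianKernel.comp (continuous_const.sub continuous_id)).aestronglyMeasurable ?_
  refine Filter.Eventually.of_forall fun y => ?_
  simp only [Real.norm_of_nonneg (gaussianKernel_pos ht _).le]
  exact gaussianKernel_le ht _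

theorem contDiff_diffusedDensity {t : ℝ} (ht : 0 < t) {p : EuclideanSpace ℝ (Fin d) → ℝ}
    (hp : Integrable p) : ContDiff ℝ 1 (diffusedDensity p t) := by
  obtain ⟨K, hK⟩ := exists_norm_fderiv_gaussianKernel_le (d := d) ht
  have hcont : Continuous (fderiv ℝ (gaussianKernel t : EuclideanSpace ℝ (Fin d) → ℝ)) :=
    (contDiff_gaussianKernel (n := 1)).continuous_fderiv one_ne_zero
  have hmeas : ∀ x : EuclideanSpace ℝ (Fin d),
      AEStronglyMeasurable fun y => p y • fderiv ℝ (gaussianKernel t) (x - y) := fun x =>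
    hp.1.smul (hcont.comp (continuous_const.sub continuous_id)).aestronglyMeasurable
  have hbound : ∀ x y : EuclideanSpace ℝ (Fin d),
      ‖p y • fderiv ℝ (gaussianKernel t) (x - y)‖ ≤ ‖p y‖ * K := fun x y => by
    rw [norm_smul]
    gcongr
    exact hK _
  have hderiv : ∀ x, HasFDerivAt (diffusedDensity p t)
      (∫ y, p y • fderiv ℝ (gaussianKernel t) (x - y)) x := by
    intro x
    refine hasFDerivAt_integral_of_dominated_of_fderiv_le
      (F := fun x y => gaussianKernel t (x - y) * p y)
      (F' := fun x y => p y • fderiv ℝ (gaussianKernel t) (x - y))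
      (bound := fun y => ‖p y‖ * K)
      Filter.univ_mem (Filter.Eventually.of_forall fun x =>
        (integrable_gaussianKernel_mul ht hp x).1) (integrable_gaussianKernel_mul ht hp x)
      (hmeas x) (Filter.Eventually.of_forall fun y x _ => hbound x y) (hp.norm.mul_const K)
      (Filter.Eventually.of_forall fun y x _ => ?_)
    have h1 : HasFDerivAt (gaussianKernel t) (fderiv ℝ (gaussianKernel t) (x - y)) (x - y) :=
      ((contDiff_gaussianKernel (n := 1)).differentiable one_ne_zero _).hasFDerivAt
    have h2 := h1.comp x ((hasFDerivAt_id x).sub_const y)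
    simpa using h2.mul_const (p y)
  refine contDiff_one_iff_fderiv.2 ⟨fun x => (hderiv x).differentiableAt, ?_⟩
  have : fderiv ℝ (diffusedDensity p t)
      = fun x => ∫ y, p y • fderiv ℝ (gaussianKernel t) (x - y) := funext fun x => (hderiv x).fderiv
  rw [this]
  refine continuous_of_dominated hmeas (fun x => Filter.Eventually.of_forall (hbound x))
    (hp.norm.mul_const K) (Filter.Eventually.of_forall fun y => ?_)
  have h1 : Continuous fun x => fderiv ℝ (gaussianKernel t) (x - y) :=
    hcont.comp (continuous_id.sub continuous_const)
  exact h1.const_smul (p y)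

theorem diffusedDensity_pos {t : ℝ} (ht : 0 < t) {p : EuclideanSpace ℝ (Fin d) → ℝ}
    (hp : IsDensity p) (x : EuclideanSpace ℝ (Fin d)) : 0 < diffusedDensity p t x := by
  have h1 : 0 < volume (Function.support p) := by
    rw [← integral_pos_iff_support_of_nonneg hp.2.1 hp.1, hp.2.2]
    exact one_pos
  unfold diffusedDensity
  rw [integral_pos_iff_support_of_nonneg
    (fun y => mul_nonneg (gaussianKernel_pos ht _).le (hp.2.1 y))
    (integrable_gaussianKernel_mul ht hp.1 x)]
  convert h1 using 2
  ext y
  simp [(gaussianKernel_pos ht (x - y)).ne']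

theorem diffusedDensity_le_of_le {t : ℝ} (ht : 0 < t) {p : EuclideanSpace ℝ (Fin d) → ℝ}
    (hp : Integrable p) {C : ℝ} (hC : ∀ x, p x ≤ C) (x : EuclideanSpace ℝ (Fin d)) :
    diffusedDensity p t x ≤ C := by
  have hg : Integrable fun y => gaussianKernel t (x - y) :=
    (integrable_gaussianKernel (d := d) ht).comp_sub_left x
  calc diffusedDensity p t x ≤ ∫ y, gaussianKernel t (x - y) * C :=
        integral_mono (integrable_gaussianKernel_mul ht hp x) (hg.mul_const C) fun y =>
          mul_le_mul_of_nonneg_left (hC y) (gaussianKernel_pos ht _).le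
    _ = C := by
        rw [integral_mul_const, integral_sub_left_eq_self (gaussianKernel t) volume x,
          integral_gaussianKernel ht, one_mul]

theorem diffusedDensity_le {t : ℝ} (ht : 0 < t) {p : EuclideanSpace ℝ (Fin d) → ℝ}
    (hp : IsDensity p) (x : EuclideanSpace ℝ (Fin d)) :
    diffusedDensity p t x ≤ (2 * Real.pi * t) ^ (-(d : ℝ) / 2) := by
  calc diffusedDensity p t x ≤ ∫ y, (2 * Real.pi * t) ^ (-(d : ℝ) / 2) * p y :=
        integral_mono (integrable_gaussianKernel_mul ht hp.1 x) (hp.1.const_mul _) fun y =>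
          mul_le_mul_of_nonneg_right (gaussianKernel_le ht _) (hp.2.1 y)
    _ = _ := by rw [integral_const_mul, hp.2.2, mul_one]

theorem volume_real_ball {h : ℝ} (hh : 0 < h) (x : EuclideanSpace ℝ (Fin d)) :
    volume.real (Metric.ball x h) =
      h ^ d * volume.real (Metric.ball (0 : EuclideanSpace ℝ (Fin d)) 1) := by
  rw [Measure.real, Measure.addHaar_ball_of_pos _ _ hh, finrank_euclideanSpace_fin,
      ENNReal.toReal_mul, ENNReal.toReal_ofReal (by positivity)]
  rfl

/-- Only the mass in the small ball is kept. Its points are within `3√t + h ≤ 4√t` of `x`, so the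
Gaussian exponent is at most `16 t / (2 t) = 8`. -/
theorem le_diffusedDensity {t h c : ℝ} (ht : 0 < t) (hh : 0 < h) (hht : h ≤ √t) (hc : 0 ≤ c)
    {p : EuclideanSpace ℝ (Fin d) → ℝ} (hp : IsDensity p) {x₀ x : EuclideanSpace ℝ (Fin d)}
    (hpc : ∀ y ∈ Metric.ball x₀ h, c ≤ p y) (hx : dist x x₀ ≤ 3 * √t) :
    c * (h ^ d * volume.real (Metric.ball (0 : EuclideanSpace ℝ (Fin d)) 1)) *
      ((2 * Real.pi * t) ^ (-(d : ℝ) / 2) * Real.exp (-8)) ≤ diffusedDensity p t x := by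
  rw [← volume_real_ball hh x₀]
  have hint := integrable_gaussianKernel_mul ht hp.1 x
  calc c * volume.real (Metric.ball x₀ h) * ((2 * Real.pi * t) ^ (-(d : ℝ) / 2) * Real.exp (-8))
      = ∫ y in Metric.ball x₀ h, ((2 * Real.pi * t) ^ (-(d : ℝ) / 2) * Real.exp (-8)) * c := by
        rw [setIntegral_const, smul_eq_mul]
        ring
    _ ≤ ∫ y in Metric.ball x₀ h, gaussianKernel t (x - y) * p y := by
        refine setIntegral_mono_on (integrableOn_const measure_ball_lt_top.ne)
          hint.integrableOn measurableSet_ball fun y hy => ?_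
        have h1 : ‖x - y‖ ≤ 4 * √t := by
          rw [← dist_eq_norm]
          have := dist_triangle x x₀ y
          have h2 : dist x₀ y < h := by rw [dist_comm]; exact hy
          linarith
        have h2 : ‖x - y‖ ^ 2 ≤ 2 * t * 8 := by
          calc ‖x - y‖ ^ 2 ≤ (4 * √t) ^ 2 := by gcongr
            _ = _ := by rw [mul_pow, Real.sq_sqrt ht.le]; ring
        exact mul_le_mul (le_gaussianKernel ht h2) (hpc y hy) hc (gaussianKernel_pos ht _).le
    _ ≤ ∫ y, gaussianKernel t (x - y) * p y :=
        setIntegral_le_integral hint (Filter.Eventually.of_forall fun y =>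
          mul_nonneg (gaussianKernel_pos ht _).le (hp.2.1 y))

end Gaussian

/-! ### Lower bounds for the Dirichlet energy from increments. -/

section Gradient

variable {d : ℕ}

theorem sq_le_lintegral_segment {u : EuclideanSpace ℝ (Fin d) → ℝ} (hu : ContDiff ℝ 1 u)
    {δ : ℝ} (hδ : 0 ≤ δ) (x v : EuclideanSpace ℝ (Fin d)) (h : δ ≤ u x - u (x - v)) :
    ENNReal.ofReal (δ ^ 2) ≤ ENNReal.ofReal (‖v‖ ^ 2) *
      ∫⁻ s in Set.Icc (0 : ℝ) 1, ‖fderiv ℝ u (x - s • v)‖ₑ ^ 2 := by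
  have hc : Continuous fun s : ℝ => ‖fderiv ℝ u (x - s • v)‖ :=
    ((hu.continuous_fderiv one_ne_zero).comp
      (continuous_const.sub (continuous_id.smul continuous_const))).norm
  have hc' : Continuous fun s : ℝ => fderiv ℝ u (x - s • v) v :=
    ((hu.continuous_fderiv one_ne_zero).comp
      (continuous_const.sub (continuous_id.smul continuous_const))).clm_apply continuous_const
  have hd : ∀ s : ℝ, HasDerivAt (fun s : ℝ => u (x - s • v)) (-fderiv ℝ u (x - s • v) v) s := by
    intro s
    have h1 : HasDerivAt (fun s : ℝ => x - s • v) (-v) s := by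
      simpa using ((hasDerivAt_id s).smul_const v).const_sub x
    refine ((hu.differentiable one_ne_zero (x - s • v)).hasFDerivAt.comp_hasDerivAt s h1).congr_deriv ?_
    simp
  have hftc : u x - u (x - v) = ∫ s in (0 : ℝ)..1, fderiv ℝ u (x - s • v) v := by
    have := intervalIntegral.integral_eq_sub_of_hasDerivAt (a := 0) (b := 1)
      (fun s _ => hd s) (hc'.neg.intervalIntegrable _ _)
    rw [intervalIntegral.integral_neg] at this
    simp only [one_smul, zero_smul, sub_zero] at this
    linarith
  have hle : δ ^ 2 ≤ ∫ s in (0 : ℝ)..1, ‖v‖ ^ 2 * ‖fderiv ℝ u (x - s • v)‖ ^ 2 := by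
    -- Cauchy–Schwarz in linearised form: `2 δ g - δ² ≤ g²` is integrated along the segment.
    calc δ ^ 2 ≤ 2 * δ * (u x - u (x - v)) - δ ^ 2 := by nlinarith
      _ = ∫ s in (0 : ℝ)..1, (2 * δ * fderiv ℝ u (x - s • v) v - δ ^ 2) := by
          rw [intervalIntegral.integral_sub ((hc'.const_mul _).intervalIntegrable _ _)
            (continuous_const.intervalIntegrable _ _), intervalIntegral.integral_const_mul, hftc]
          simp
      _ ≤ _ := by
          refine intervalIntegral.integral_mono_on zero_le_one
            (((hc'.const_mul _).sub continuous_const).intervalIntegrable _ _)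
            (((hc.pow 2).const_mul _).intervalIntegrable _ _) fun s _ => ?_
          have h1 : (fderiv ℝ u (x - s • v) v) ^ 2 ≤ ‖v‖ ^ 2 * ‖fderiv ℝ u (x - s • v)‖ ^ 2 := by
            rw [← mul_pow, ← sq_abs, mul_comm]
            gcongr
            exact (fderiv ℝ u (x - s • v)).le_opNorm v
          nlinarith [sq_nonneg (fderiv ℝ u (x - s • v) v - δ)]
  refine (ENNReal.ofReal_le_ofReal hle).trans ?_
  rw [intervalIntegral.integral_const_mul, ENNReal.ofReal_mul (by positivity)]
  gcongr
  rw [intervalIntegral.integral_of_le zero_le_one, ← integral_Icc_eq_integral_Ioc,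
    ofReal_integral_eq_lintegral_ofReal (f := fun s => ‖fderiv ℝ u (x - s • v)‖ ^ 2)
      (Continuous.integrableOn_Icc (by exact hc.pow 2)) (Filter.Eventually.of_forall fun s => by positivity)]
  refine lintegral_mono fun s => ?_
  simp only
  rw [ENNReal.ofReal_pow (norm_nonneg _), ofReal_norm]

/-- A function that changes by at least `δ` along all translates by `v` of the points of `B` has
Dirichlet energy at least `δ² vol(B) / ‖v‖²` on the region swept by the translates. -/
theorem sq_mul_volume_le_lintegral_fderiv {u : EuclideanSpace ℝ (Fin d) → ℝ}
    (hu : ContDiff ℝ 1 u) {δ : ℝ} (hδ : 0 ≤ δ) {v : EuclideanSpace ℝ (Fin d)}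
    {B S : Set (EuclideanSpace ℝ (Fin d))} (hB : MeasurableSet B) (hS : MeasurableSet S)
    (hBS : ∀ x ∈ B, ∀ s ∈ Set.Icc (0 : ℝ) 1, x - s • v ∈ S)
    (h : ∀ x ∈ B, δ ≤ u x - u (x - v)) :
    ENNReal.ofReal (δ ^ 2) * volume B ≤
      ENNReal.ofReal (‖v‖ ^ 2) * ∫⁻ x in S, ‖fderiv ℝ u x‖ₑ ^ 2 := by
  have hmeas : Measurable fun z : EuclideanSpace ℝ (Fin d) × ℝ =>
      ‖fderiv ℝ u (z.1 - z.2 • v)‖ₑ ^ 2 := by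
    have hc : Continuous fun z : EuclideanSpace ℝ (Fin d) × ℝ => fderiv ℝ u (z.1 - z.2 • v) :=
      (hu.continuous_fderiv one_ne_zero).comp (by fun_prop)
    exact (hc.enorm.measurable).pow_const 2
  calc ENNReal.ofReal (δ ^ 2) * volume B
      = ∫⁻ _ in B, ENNReal.ofReal (δ ^ 2) := by rw [setLIntegral_const]
    _ ≤ ∫⁻ x in B, ENNReal.ofReal (‖v‖ ^ 2) *
          ∫⁻ s in Set.Icc (0 : ℝ) 1, ‖fderiv ℝ u (x - s • v)‖ₑ ^ 2 :=
        setLIntegral_mono' hB fun x hx => sq_le_lintegral_segment hu hδ x v (h x hx)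
    _ = ENNReal.ofReal (‖v‖ ^ 2) *
          ∫⁻ s in Set.Icc (0 : ℝ) 1, ∫⁻ x in B, ‖fderiv ℝ u (x - s • v)‖ₑ ^ 2 := by
        rw [lintegral_const_mul' _ _ ENNReal.ofReal_ne_top]
        congr 1
        exact lintegral_lintegral_swap hmeas.aemeasurable
    _ ≤ ENNReal.ofReal (‖v‖ ^ 2) *
          ∫⁻ _ in Set.Icc (0 : ℝ) 1, ∫⁻ x in S, ‖fderiv ℝ u x‖ₑ ^ 2 := by
        gcongr 1
        refine setLIntegral_mono' measurableSet_Icc fun s hs => ?_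
        -- For fixed `s` the translate of `B` by `-s • v` lies in `S`, so translation invariance
        -- suffices.
        rw [← lintegral_indicator hB, ← lintegral_indicator hS,
          ← lintegral_sub_right_eq_self (S.indicator _) (s • v)]
        refine lintegral_mono fun x => ?_
        by_cases hx : x ∈ B
        · simp [hx, hBS x hx s hs]
        · simp [hx]
    _ = _ := by simp

end Gradient

/-! ### Odd bumps and their Gaussian smoothing. -/

section Bump

variable {d : ℕ}

/-- A bump at `e` minus the same bump at `-e`. -/
def oddBump (b : ContDiffBump (0 : EuclideanSpace ℝ (Fin d))) (e : EuclideanSpace ℝ (Fin d))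
    (y : EuclideanSpace ℝ (Fin d)) : ℝ :=
  b (y - e) - b (y + e)

variable {b : ContDiffBump (0 : EuclideanSpace ℝ (Fin d))} {e : EuclideanSpace ℝ (Fin d)}

theorem oddBump_neg (y : EuclideanSpace ℝ (Fin d)) : oddBump b e (-y) = -oddBump b e y := by
  unfold oddBump
  rw [show -y - e = -(y + e) by abel, show -y + e = -(y - e) by abel, b.neg, b.neg]
  ring

theorem contDiff_oddBump {n : ℕ∞} : ContDiff ℝ n (oddBump b e) :=
  (b.contDiff.comp (contDiff_id.sub contDiff_const)).sub
    (b.contDiff.comp (contDiff_id.add contDiff_const))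

theorem oddBump_eq_zero (hb : b.rOut = 1 / 2) (he : ‖e‖ = 1) {y : EuclideanSpace ℝ (Fin d)}
    (hy : 3 / 2 ≤ ‖y‖) : oddBump b e y = 0 := by
  unfold oddBump
  rw [b.zero_of_le_dist, b.zero_of_le_dist, sub_zero]
  · rw [hb, dist_zero_right]
    have := norm_sub_norm_le y (-e)
    rw [norm_neg, sub_neg_eq_add] at this
    linarith
  · rw [hb, dist_zero_right]
    have := norm_sub_norm_le y e
    linarith

theorem tsupport_oddBump_subset (hb : b.rOut = 1 / 2) (he : ‖e‖ = 1) :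
    tsupport (oddBump b e) ⊆ Metric.closedBall 0 (3 / 2) := by
  refine closure_minimal (fun y hy => ?_) Metric.isClosed_closedBall
  by_contra h
  rw [mem_closedBall_zero_iff, not_le] at h
  exact hy (oddBump_eq_zero hb he h.le)

theorem hasCompactSupport_oddBump (hb : b.rOut = 1 / 2) (he : ‖e‖ = 1) :
    HasCompactSupport (oddBump b e) :=
  (isCompact_closedBall _ _).of_isClosed_subset (isClosed_tsupport _)
    (tsupport_oddBump_subset hb he)

theorem abs_oddBump_le (y : EuclideanSpace ℝ (Fin d)) : |oddBump b e y| ≤ 1 := by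
  unfold oddBump
  rw [abs_le]
  constructor <;> linarith [b.nonneg' (y - e), b.nonneg' (y + e), b.le_one (x := y - e),
    b.le_one (x := y + e)]

theorem integral_comp_inv_smul_sub (f : EuclideanSpace ℝ (Fin d) → ℝ) {h : ℝ} (hh : 0 < h)
    (z : EuclideanSpace ℝ (Fin d)) :
    ∫ y, f (h⁻¹ • y - z) = h ^ d * ∫ y, f y := by
  rw [Measure.integral_comp_smul volume (fun y => f (y - z)) h⁻¹, finrank_euclideanSpace_fin,
    inv_pow, inv_inv, abs_of_pos (by positivity), integral_sub_right_eq_self, smul_eq_mul]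

theorem integrable_comp_inv_smul_sub {f : EuclideanSpace ℝ (Fin d) → ℝ} (hf : Integrable f)
    {h : ℝ} (hh : 0 < h) (z : EuclideanSpace ℝ (Fin d)) :
    Integrable fun y => f (h⁻¹ • y - z) :=
  (hf.comp_sub_right z).comp_smul (inv_ne_zero hh.ne')

theorem integrable_oddBump : Integrable (oddBump b e) := by
  unfold oddBump
  exact (b.integrable.comp_sub_right e).sub (b.integrable.comp_add_right e)

theorem integral_oddBump : ∫ y, oddBump b e y = 0 := by
  unfold oddBump
  rw [integral_sub (b.integrable.comp_sub_right e) (b.integrable.comp_add_right e),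
    integral_sub_right_eq_self, integral_add_right_eq_self, sub_self]

/-- The kernel is even and the bump is odd, so the smoothed bump is odd about its centre `h • z`.
One lower bound thus controls both lobes. -/
theorem diffusedDensity_oddBump_reflect {t h : ℝ} (hh : 0 < h)
    (z x : EuclideanSpace ℝ (Fin d)) :
    diffusedDensity (fun y => oddBump b e (h⁻¹ • y - z)) t (2 • (h • z) - x)
      = -diffusedDensity (fun y => oddBump b e (h⁻¹ • y - z)) t x := by
  unfold diffusedDensity
  rw [← integral_sub_left_eq_self _ volume (2 • (h • z)), ← integral_neg]
  congr 1
  ext y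
  have e1 : 2 • (h • z) - x - (2 • (h • z) - y) = -(x - y) := by abel
  have e2 : h⁻¹ • (2 • (h • z) - y) - z = -(h⁻¹ • y - z) := by
    rw [smul_sub, smul_comm h⁻¹ 2, smul_smul, inv_mul_cancel₀ hh.ne', one_smul]
    abel
  simp only [e1, e2, oddBump_neg]
  simp [gaussianKernel, norm_sub_rev y x]

/-- For `x` near `h • z + √t • e` the positive copy of the bump is closer than the negative one. The
two Gaussian contributions nearly cancel when `r = h / √t` is small. This dipole cancellation costs
one factor `r` beyond the `r^d` coming from the volume of the bump. -/
theorem le_diffusedDensity_oddBump {t h : ℝ} (ht : 0 < t) (hh : 0 < h) (hht : h ≤ √t)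
    (hb : b.rOut = 1 / 2) (he : ‖e‖ = 1) (z : EuclideanSpace ℝ (Fin d))
    {x : EuclideanSpace ℝ (Fin d)} (hx : x ∈ Metric.ball (h • z + √t • e) (√t / 4)) :
    (2 * Real.pi) ^ (-(d : ℝ) / 2) * Real.exp (-5) / 4 * (∫ y, b y) * (h / √t) ^ (d + 1) ≤
      diffusedDensity (fun y => oddBump b e (h⁻¹ • y - z)) t x := by
  have hst : 0 < √t := Real.sqrt_pos.2 ht
  have hst2 : √t ^ 2 = t := Real.sq_sqrt ht.le
  set r := h / √t with hr
  have hr0 : 0 < r := by positivity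
  have hr1 : r ≤ 1 := (div_le_one hst).2 hht
  have hrh : h = r * √t := by rw [hr]; field_simp
  set w := x - h • z - √t • e with hw
  have hwn : ‖w‖ < √t / 4 := by
    rw [Metric.mem_ball, dist_eq_norm] at hx
    rwa [hw, sub_sub]
  have hint : ∀ a : EuclideanSpace ℝ (Fin d),
      Integrable fun y => gaussianKernel t (x - h • (y + a)) * b y := fun a => by
    refine (b.integrable (μ := volume)).bdd_mul (c := (2 * Real.pi * t) ^ (-(d : ℝ) / 2))
      (continuous_gaussianKernel.comp (by fun_prop)).aestronglyMeasurable ?_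
    refine Filter.Eventually.of_forall fun y => ?_
    simp only [Real.norm_of_nonneg (gaussianKernel_pos ht _).le]
    exact gaussianKernel_le ht _
  have hsub : ∀ a : EuclideanSpace ℝ (Fin d),
      (Integrable fun y => gaussianKernel t (x - y) * b (h⁻¹ • y - a)) ∧
      ∫ y, gaussianKernel t (x - y) * b (h⁻¹ • y - a)
        = h ^ d * ∫ y, gaussianKernel t (x - h • (y + a)) * b y := by
    intro a
    have e1 : (fun y => gaussianKernel t (x - y) * b (h⁻¹ • y - a)) = fun y =>
        (fun y' => gaussianKernel t (x - h • (y' + a)) * b y') (h⁻¹ • y - a) := by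
      ext y
      simp only [sub_add_cancel, smul_smul, mul_inv_cancel₀ hh.ne', one_smul]
    rw [e1]
    exact ⟨integrable_comp_inv_smul_sub (hint a) hh a, integral_comp_inv_smul_sub
      (fun y' => gaussianKernel t (x - h • (y' + a)) * b y') hh a⟩
  have heq : diffusedDensity (fun y => oddBump b e (h⁻¹ • y - z)) t x
      = h ^ d * ∫ y, (gaussianKernel t (x - h • (y + (z + e)))
          - gaussianKernel t (x - h • (y + (z - e)))) * b y := by
    simp only [sub_mul]
    rw [integral_sub (hint _) (hint _), mul_sub, ← (hsub (z + e)).2, ← (hsub (z - e)).2,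
      ← integral_sub (hsub _).1 (hsub _).1]
    unfold diffusedDensity oddBump
    congr 1
    ext y
    rw [show h⁻¹ • y - (z + e) = h⁻¹ • y - z - e by abel,
      show h⁻¹ • y - (z - e) = h⁻¹ • y - z + e by abel]
    ring
  have hpt : ∀ y : EuclideanSpace ℝ (Fin d), ‖y‖ ≤ 1 / 2 →
      (2 * Real.pi * t) ^ (-(d : ℝ) / 2) * Real.exp (-5) * (r / 4) ≤
        gaussianKernel t (x - h • (y + (z + e))) - gaussianKernel t (x - h • (y + (z - e))) := by
    -- `A` and `A + 2 h e` are the displacements from `x` to matching points of the positive and the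
    -- negative copy. Their squared lengths differ by at least `h √t = r t`, so the kernels have
    -- ratio at most `exp (-r / 2) ≤ 1 - r / 4`.
    intro y hy
    set A := x - h • (y + (z + e)) with hA
    have hAw : A = w + ((√t - h) • e - h • y) := by
      rw [hA, hw, smul_add, smul_add, sub_smul]; abel
    have hB : x - h • (y + (z - e)) = A + (2 * h) • e := by
      rw [hA, smul_add, smul_add, smul_add, smul_sub, two_mul, add_smul]; abel
    have hAn : ‖A‖ ≤ 2 * √t := by
      have h1 : ‖(√t - h) • e - h • y‖ ≤ (√t - h) + h * (1 / 2) := by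
        refine (norm_sub_le _ _).trans ?_
        rw [norm_smul, norm_smul, he, Real.norm_of_nonneg (by linarith),
          Real.norm_of_nonneg hh.le, mul_one]
        gcongr
      rw [hAw]
      have := norm_add_le w ((√t - h) • e - h • y)
      linarith
    have hinner : √t / 4 - h / 2 ≤ inner ℝ A e + h - √t / 2 := by
      have h1 : inner ℝ A e = inner ℝ w e + (√t - h) - h * inner ℝ y e := by
        rw [hAw, inner_add_left w, inner_sub_left (_ • e), inner_smul_left, inner_smul_left,
          real_inner_self_eq_norm_sq, he]
        simp
        ring
      have h2 : |inner ℝ w e| ≤ ‖w‖ := by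
        simpa [he] using abs_real_inner_le_norm w e
      have h3 : |inner ℝ y e| ≤ ‖y‖ := by
        simpa [he] using abs_real_inner_le_norm y e
      have h4 := (abs_le.1 h2).1
      have h5 := (abs_le.1 h3).2
      have h6 : h * inner ℝ y e ≤ h * (1 / 2) := by gcongr; linarith
      linarith
    have hBn : ‖A‖ ^ 2 + 4 * h * (inner ℝ A e + h) = ‖A + (2 * h) • e‖ ^ 2 := by
      rw [norm_add_sq_real, inner_smul_right, norm_smul, he, Real.norm_of_nonneg (by positivity)]
      ring
    have hratio : gaussianKernel t (A + (2 * h) • e) ≤ gaussianKernel t A * Real.exp (-(r / 2)) := by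
      unfold gaussianKernel
      rw [mul_assoc _ (Real.exp _), ← Real.exp_add]
      gcongr
      rw [← hBn]
      have h1 : r * t ≤ 4 * h * (inner ℝ A e + h) := by
        have h2 : r * t = h * √t := by rw [hrh, mul_assoc, Real.mul_self_sqrt ht.le]
        rw [h2]
        nlinarith
      have h2 : r / 2 = r * t / (2 * t) := by field_simp
      rw [h2, neg_div, neg_div, ← neg_add, ← add_div, neg_le_neg_iff]
      gcongr
    have hexp : Real.exp (-(r / 2)) ≤ 1 - r / 4 := by
      have h2 : Real.exp (-(r / 2)) * (1 + r / 2) ≤ 1 := by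
        calc Real.exp (-(r / 2)) * (1 + r / 2) ≤ Real.exp (-(r / 2)) * Real.exp (r / 2) := by
              gcongr
              linarith [Real.add_one_le_exp (r / 2)]
          _ = 1 := by rw [← Real.exp_add, neg_add_cancel, Real.exp_zero]
      nlinarith [Real.exp_pos (-(r / 2))]
    rw [hB]
    have hA2 : ‖A‖ ^ 2 ≤ 2 * t * 5 := by
      calc ‖A‖ ^ 2 ≤ (2 * √t) ^ 2 := by gcongr
        _ ≤ _ := by rw [mul_pow, hst2]; linarith
    have hAk := le_gaussianKernel (d := d) ht hA2
    have hAp := gaussianKernel_pos ht A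
    calc _ ≤ gaussianKernel t A * (r / 4) := by gcongr
      _ ≤ gaussianKernel t A * (1 - Real.exp (-(r / 2))) := by gcongr; linarith
      _ ≤ _ := by linarith
  rw [heq]
  have hscale : (2 * Real.pi) ^ (-(d : ℝ) / 2) * Real.exp (-5) / 4 * (∫ y, b y) * r ^ (d + 1)
      = h ^ d * ∫ y, (2 * Real.pi * t) ^ (-(d : ℝ) / 2) * Real.exp (-5) * (r / 4) * b y := by
    rw [integral_const_mul, Real.mul_rpow (by positivity) ht.le]
    have h1 : t ^ (-(d : ℝ) / 2) = (√t ^ d)⁻¹ := by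
      rw [neg_div, Real.rpow_neg ht.le, ← Real.rpow_natCast, Real.sqrt_eq_rpow, ← Real.rpow_mul ht.le]
      congr 2
      ring
    rw [h1, pow_succ, hr, div_pow]
    field_simp
  rw [hscale]
  refine mul_le_mul_of_nonneg_left (integral_mono (b.integrable.const_mul _) ?_ fun y => ?_)
    (by positivity)
  · simp only [sub_mul]
    exact (hint _).sub (hint _)
  · rcases le_or_gt ‖y‖ (1 / 2) with hy | hy
    · exact mul_le_mul_of_nonneg_right (hpt y hy) (b.nonneg' y)
    · have : b y = 0 := b.zero_of_le_dist (by rw [hb, dist_zero_right]; exact hy.le)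
      simp [this]

end Bump

/-! ### Separation of the scores of two densities differing by one odd bump. -/

section Score

variable {d : ℕ}

theorem contDiff_log_diffusedDensity {t : ℝ} (ht : 0 < t) {p : EuclideanSpace ℝ (Fin d) → ℝ}
    (hp : IsDensity p) : ContDiff ℝ 1 fun x => Real.log (diffusedDensity p t x) :=
  (contDiff_diffusedDensity ht hp.1).log fun x => (diffusedDensity_pos ht hp x).ne'

theorem measurable_score {t : ℝ} (ht : 0 < t) {p : EuclideanSpace ℝ (Fin d) → ℝ}
    (hp : IsDensity p) : Measurable (score p t) := by
  have h := (contDiff_log_diffusedDensity ht hp).continuous_fderiv one_ne_zero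
  exact ((InnerProductSpace.toDual ℝ _).symm.continuous.comp h).measurable

theorem enorm_score_sub {t : ℝ} (ht : 0 < t) {p q : EuclideanSpace ℝ (Fin d) → ℝ}
    (hp : IsDensity p) (hq : IsDensity q) (x : EuclideanSpace ℝ (Fin d)) :
    ‖score q t x - score p t x‖ₑ = ‖fderiv ℝ (fun y => Real.log (diffusedDensity q t y) -
      Real.log (diffusedDensity p t y)) x‖ₑ := by
  rw [fderiv_fun_sub ((contDiff_log_diffusedDensity ht hq).differentiable one_ne_zero x)
    ((contDiff_log_diffusedDensity ht hp).differentiable one_ne_zero x)]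
  unfold score gradient
  rw [← map_sub, LinearIsometryEquiv.enorm_map]

theorem diffusedDensity_add_mul {t : ℝ} (ht : 0 < t) {p f : EuclideanSpace ℝ (Fin d) → ℝ}
    (hp : Integrable p) (hf : Integrable f) (A : ℝ) (x : EuclideanSpace ℝ (Fin d)) :
    diffusedDensity (fun y => p y + A * f y) t x
      = diffusedDensity p t x + A * diffusedDensity f t x := by
  unfold diffusedDensity
  rw [← integral_const_mul, ← integral_add (integrable_gaussianKernel_mul ht hp x)
    ((integrable_gaussianKernel_mul ht hf x).const_mul A)]
  congr 1
  ext y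
  ring

theorem div_le_log_sub_log {a b G U : ℝ} (ha : 0 < a) (hb : 0 < b) (hU : b ≤ U) (hG : 0 ≤ G)
    (h : a + G ≤ b) : G / U ≤ Real.log b - Real.log a := by
  rw [← Real.log_div hb.ne' ha.ne']
  have h1 := Real.one_sub_inv_le_log_of_pos (div_pos hb ha)
  rw [inv_div] at h1
  refine le_trans ?_ h1
  rw [one_sub_div hb.ne']
  calc G / U ≤ G / b := by gcongr
    _ ≤ (b - a) / b := by gcongr; linarith

variable {b : ContDiffBump (0 : EuclideanSpace ℝ (Fin d))} {e : EuclideanSpace ℝ (Fin d)}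

/-- Adding an odd bump of width `h ≤ √t` and height `A` to a density moves its score at time `t`. -/
theorem le_lintegral_score_sub {t h A U : ℝ} (ht : 0 < t) (hh : 0 < h) (hht : h ≤ √t) (hA : 0 ≤ A)
    (hU : 0 < U) (hb : b.rOut = 1 / 2) (he : ‖e‖ = 1) (z : EuclideanSpace ℝ (Fin d))
    {p q : EuclideanSpace ℝ (Fin d) → ℝ} (hp : IsDensity p) (hq : IsDensity q)
    (hpq : ∀ y, q y = p y + A * oddBump b e (h⁻¹ • y - z))
    (hpU : ∀ x, diffusedDensity p t x ≤ U) (hqU : ∀ x, diffusedDensity q t x ≤ U) :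
    ENNReal.ofReal ((2 * (A * ((2 * Real.pi) ^ (-(d : ℝ) / 2) * Real.exp (-5) / 4 * (∫ y, b y) *
        (h / √t) ^ (d + 1))) / U) ^ 2 * ((√t / 4) ^ d *
        volume.real (Metric.ball (0 : EuclideanSpace ℝ (Fin d)) 1)) / (4 * t)) ≤
      ∫⁻ x in Metric.ball (h • z) (3 * √t), ‖score q t x - score p t x‖ₑ ^ 2 := by
  have hst : 0 < √t := Real.sqrt_pos.2 ht
  have hst2 : √t ^ 2 = t := Real.sq_sqrt ht.le
  set G := A * ((2 * Real.pi) ^ (-(d : ℝ) / 2) * Real.exp (-5) / 4 * (∫ y, b y) *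
        (h / √t) ^ (d + 1)) with hG
  have hG0 : 0 ≤ G := by
    have := b.integral_pos (μ := volume)
    positivity
  set g := diffusedDensity (fun y => oddBump b e (h⁻¹ • y - z)) t with hg
  have hfint : Integrable fun y => oddBump b e (h⁻¹ • y - z) :=
    integrable_comp_inv_smul_sub integrable_oddBump hh z
  have hqg : ∀ x, diffusedDensity q t x = diffusedDensity p t x + A * g x := by
    intro x
    rw [hg, ← diffusedDensity_add_mul ht hp.1 hfint]
    congr 1
    exact funext hpq
  have hgB : ∀ x ∈ Metric.ball (h • z + √t • e) (√t / 4), G ≤ A * g x := fun x hx =>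
    mul_le_mul_of_nonneg_left (le_diffusedDensity_oddBump ht hh hht hb he z hx) hA
  -- The log-ratio is at least `G / U` at `x` and at most `-G / U` at `x - 2√t e`, whose reflection
  -- in the centre `h • z` lies again in the ball.
  have hsep : ∀ x ∈ Metric.ball (h • z + √t • e) (√t / 4),
      2 * G / U ≤ (Real.log (diffusedDensity q t x) - Real.log (diffusedDensity p t x)) -
        (Real.log (diffusedDensity q t (x - (2 * √t) • e)) -
          Real.log (diffusedDensity p t (x - (2 * √t) • e))) := by
    intro x hx
    have h1 := div_le_log_sub_log (diffusedDensity_pos ht hp x) (diffusedDensity_pos ht hq x)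
      (hqU x) hG0 (by rw [hqg]; linarith [hgB x hx])
    set x' := x - (2 * √t) • e with hx'
    have h2 : G ≤ -(A * g x') := by
      have h3 : 2 • (h • z) - x' ∈ Metric.ball (h • z + √t • e) (√t / 4) := by
        rw [Metric.mem_ball, dist_eq_norm] at hx ⊢
        rw [← norm_neg]
        have h3 : -(2 • (h • z) - x' - (h • z + √t • e)) = x - (h • z + √t • e) := by
          rw [hx', mul_smul, two_smul ℝ, two_smul ℕ]
          abel
        rwa [h3]
      have h4 := hgB _ h3
      rw [hg, diffusedDensity_oddBump_reflect hh, ← hg] at h4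
      linarith
    have h3 := div_le_log_sub_log (diffusedDensity_pos ht hq x') (diffusedDensity_pos ht hp x')
      (hpU x') hG0 (by rw [hqg]; linarith)
    rw [mul_div_assoc]
    linarith
  have hseg : ∀ x ∈ Metric.ball (h • z + √t • e) (√t / 4), ∀ s ∈ Set.Icc (0 : ℝ) 1,
      x - s • (2 * √t) • e ∈ Metric.ball (h • z) (3 * √t) := by
    intro x hx s hs
    rw [Metric.mem_ball, dist_eq_norm] at hx ⊢
    have h1 : x - s • (2 * √t) • e - h • z
        = (x - (h • z + √t • e)) + (√t * (1 - 2 * s)) • e := by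
      rw [smul_smul, mul_sub, sub_smul, mul_one, show √t * (2 * s) = s * (2 * √t) by ring]
      abel
    rw [h1]
    refine (norm_add_le _ _).trans_lt ?_
    rw [norm_smul, he, mul_one, Real.norm_eq_abs, abs_mul, abs_of_pos hst]
    have h2 : |1 - 2 * s| ≤ 1 := abs_le.2 ⟨by linarith [hs.2], by linarith [hs.1]⟩
    nlinarith
  have key := sq_mul_volume_le_lintegral_fderiv
    ((contDiff_log_diffusedDensity ht hq).sub (contDiff_log_diffusedDensity ht hp))
    (δ := 2 * G / U) (by positivity) measurableSet_ball measurableSet_ball hseg hsep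
  have hv : ‖(2 * √t) • e‖ ^ 2 = 4 * t := by
    rw [norm_smul, he, mul_one, Real.norm_of_nonneg (by positivity), mul_pow, hst2]
    ring
  rw [hv] at key
  have hvol : volume (Metric.ball (h • z + √t • e) (√t / 4)) = ENNReal.ofReal ((√t / 4) ^ d *
        volume.real (Metric.ball (0 : EuclideanSpace ℝ (Fin d)) 1)) := by
    rw [← volume_real_ball (by positivity) (h • z + √t • e), Measure.real,
      ENNReal.ofReal_toReal measure_ball_lt_top.ne]
  rw [hvol, ← ENNReal.ofReal_mul (by positivity)] at key
  rw [ENNReal.ofReal_div_of_pos (by positivity)]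
  refine ENNReal.div_le_of_le_mul' (key.trans (le_of_eq ?_))
  simp_rw [enorm_score_sub ht hp hq]

end Score

/-! ### Two-point testing bound for product measures. -/

section LeCam

variable {X : Type*} [MeasurableSpace X]

theorem lintegral_pi_prod (n : ℕ) (μ : Measure X) [IsProbabilityMeasure μ] {ρ : X → ENNReal}
    (hρ : Measurable ρ) :
    ∫⁻ x : Fin n → X, ∏ i, ρ (x i) ∂(Measure.pi fun _ => μ) = (∫⁻ x, ρ x ∂μ) ^ n := by
  have h := ProbabilityTheory.iIndepFun_pi (μ := fun _ : Fin n => μ) (X := fun _ => ρ)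
    fun _ => hρ.aemeasurable
  have h1 := ProbabilityTheory.lintegral_prod_eq_prod_lintegral_of_indepFun Finset.univ
    (fun (i : Fin n) (x : Fin n → X) => ρ (x i)) h (fun i => hρ.comp (measurable_pi_apply i))
  rw [h1]
  have h2 : ∀ i : Fin n, ∫⁻ x : Fin n → X, ρ (x i) ∂(Measure.pi fun _ => μ) = ∫⁻ x, ρ x ∂μ :=
    fun i => (measurePreserving_eval (fun _ => μ) i).lintegral_comp hρ
  simp [h2]

theorem pi_withDensity (n : ℕ) (μ : Measure X) [IsProbabilityMeasure μ] {ρ : X → ENNReal}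
    (hρ : Measurable ρ) [SigmaFinite (μ.withDensity ρ)] :
    Measure.pi (fun _ : Fin n => μ.withDensity ρ)
      = (Measure.pi fun _ : Fin n => μ).withDensity fun x => ∏ i, ρ (x i) := by
  refine Measure.pi_eq fun s hs => ?_
  have hm : MeasurableSet (Set.univ.pi s) := MeasurableSet.univ_pi hs
  rw [withDensity_apply _ hm, ← lintegral_indicator hm]
  have e : ∀ x : Fin n → X, (Set.univ.pi s).indicator (fun x => ∏ i, ρ (x i)) x
      = ∏ i, (s i).indicator ρ (x i) := by
    intro x
    by_cases hx : x ∈ Set.univ.pi s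
    · rw [Set.indicator_of_mem hx]
      exact Finset.prod_congr rfl fun i _ => (Set.indicator_of_mem (hx i trivial) _).symm
    · rw [Set.indicator_of_notMem hx]
      simp only [Set.mem_univ_pi, not_forall] at hx
      obtain ⟨i, hi⟩ := hx
      exact (Finset.prod_eq_zero (Finset.mem_univ i) (Set.indicator_of_notMem hi _)).symm
  simp_rw [e]
  have h := ProbabilityTheory.iIndepFun_pi (μ := fun _ : Fin n => μ)
    (X := fun i => (s i).indicator ρ) fun i => (hρ.indicator (hs i)).aemeasurable
  have h1 := ProbabilityTheory.lintegral_prod_eq_prod_lintegral_of_indepFun Finset.univ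
    (fun (i : Fin n) (x : Fin n → X) => (s i).indicator ρ (x i)) h
    (fun i => (hρ.indicator (hs i)).comp (measurable_pi_apply i))
  rw [h1]
  refine Finset.prod_congr rfl fun i _ => ?_
  rw [(measurePreserving_eval (fun _ : Fin n => μ) i).lintegral_comp (hρ.indicator (hs i)),
    lintegral_indicator (hs i), withDensity_apply _ (hs i)]

theorem one_add_inv_pow_le (n : ℕ) (hn : n ≠ 0) :
    (1 + (n : ENNReal)⁻¹) ^ n ≤ 3 := by
  have hn' : (0 : ℝ) < n := by positivity
  have e : (1 + (n : ENNReal)⁻¹) = ENNReal.ofReal (1 + (n : ℝ)⁻¹) := by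
    rw [ENNReal.ofReal_add zero_le_one (by positivity), ENNReal.ofReal_one,
      ENNReal.ofReal_inv_of_pos hn', ENNReal.ofReal_natCast]
  rw [e, ← ENNReal.ofReal_pow (by positivity)]
  have h : (1 + (n : ℝ)⁻¹) ^ n ≤ 3 := by
    calc (1 + (n : ℝ)⁻¹) ^ n ≤ (Real.exp (n : ℝ)⁻¹) ^ n := by
          gcongr
          linarith [Real.add_one_le_exp (n : ℝ)⁻¹]
      _ = Real.exp 1 := by
          rw [← Real.exp_nat_mul, mul_inv_cancel₀ hn'.ne']
      _ ≤ 3 := Real.exp_one_lt_three.le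
  calc _ ≤ ENNReal.ofReal 3 := ENNReal.ofReal_le_ofReal h
    _ = 3 := by norm_num

/-- For finite `R ≥ 1` this is `(R / 2 - 1)² ≥ 0`. It bounds the overlap `∫ min 1 R` from below by
the second moment of the likelihood ratio alone. -/
theorem le_min_one_add (R : ENNReal) : R ≤ min 1 R + R ^ 2 / 4 := by
  rcases le_total R 1 with h | h
  · rw [min_eq_right h]; exact le_self_add
  · rw [min_eq_left h]
    by_cases hR : R = ⊤
    · subst hR; simp [ENNReal.top_div]
    · lift R to NNReal using hR
      have : (R : ENNReal) ^ 2 / 4 = ((R ^ 2 / 4 : NNReal) : ENNReal) := by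
        rw [ENNReal.coe_div (by norm_num)]; simp
      rw [this]
      norm_cast
      rw [← NNReal.coe_le_coe]
      push_cast
      nlinarith [sq_nonneg ((R : ℝ) / 2 - 1)]

/-- Two-point lower bound: losses which cannot both be small, under product measures whose
chi-square divergence per observation is at most `1 / n`. -/
theorem le_lintegral_add_lintegral {n : ℕ} (hn : n ≠ 0) (μ : Measure X) [IsProbabilityMeasure μ]
    {ρ : X → ENNReal} (hρ : Measurable ρ) [IsProbabilityMeasure (μ.withDensity ρ)]
    (hρ2 : ∫⁻ x, ρ x ^ 2 ∂μ ≤ 1 + (n : ENNReal)⁻¹) {f g : (Fin n → X) → ENNReal}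
    (hf : Measurable f) (hg : Measurable g) {δ : ENNReal} (hδ : ∀ x, δ ≤ f x + g x) :
    δ / 4 ≤ ∫⁻ x, f x ∂(Measure.pi fun _ => μ) +
      ∫⁻ x, g x ∂(Measure.pi fun _ => μ.withDensity ρ) := by
  set R : (Fin n → X) → ENNReal := fun x => ∏ i, ρ (x i) with hR
  have hRm : Measurable R := Finset.measurable_fun_prod _ fun i _ => hρ.comp (measurable_pi_apply i)
  have hρ1 : ∫⁻ x, ρ x ∂μ = 1 := by
    have := measure_univ (μ := μ.withDensity ρ)
    rwa [withDensity_apply _ MeasurableSet.univ, Measure.restrict_univ] at this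
  have hR1 : ∫⁻ x, R x ∂(Measure.pi fun _ => μ) = 1 := by
    rw [hR, lintegral_pi_prod n μ hρ, hρ1, one_pow]
  have hR2 : ∫⁻ x, R x ^ 2 ∂(Measure.pi fun _ => μ) ≤ 3 := by
    have e : ∀ x, R x ^ 2 = ∏ i, (ρ (x i)) ^ 2 := fun x => by rw [hR, Finset.prod_pow]
    simp_rw [e]
    rw [lintegral_pi_prod n μ (hρ.pow_const 2)]
    exact (pow_le_pow_left' hρ2 n).trans (one_add_inv_pow_le n hn)
  -- The ratio has mean `1` and second moment at most `(1 + 1/n)^n ≤ 3`, so the overlap is at least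
  -- `1 - 3/4`.
  have hmin : 4⁻¹ ≤ ∫⁻ x, min 1 (R x) ∂(Measure.pi fun _ => μ) := by
    have h1 : 1 ≤ ∫⁻ x, min 1 (R x) ∂(Measure.pi fun _ => μ) + 3 / 4 := by
      calc 1 = ∫⁻ x, R x ∂(Measure.pi fun _ => μ) := hR1.symm
        _ ≤ ∫⁻ x, (min 1 (R x) + R x ^ 2 / 4) ∂(Measure.pi fun _ => μ) :=
            lintegral_mono fun x => le_min_one_add (R x)
        _ = ∫⁻ x, min 1 (R x) ∂(Measure.pi fun _ => μ) +
              (∫⁻ x, R x ^ 2 ∂(Measure.pi fun _ => μ)) / 4 := by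
            rw [lintegral_add_left (measurable_const.min hRm)]
            simp_rw [div_eq_mul_inv]
            rw [lintegral_mul_const _ (hRm.pow_const 2)]
        _ ≤ _ := by gcongr
    have h2 : (4⁻¹ : ENNReal) + 3 / 4 = 1 := by
      rw [← one_div, ENNReal.div_add_div_same]
      norm_num
      exact ENNReal.div_self (by norm_num) (by norm_num)
    refine (ENNReal.add_le_add_iff_right (a := 3 / 4) (by finiteness)).1 ?_
    rwa [h2]
  calc δ / 4 = δ * 4⁻¹ := div_eq_mul_inv _ _
    _ ≤ δ * ∫⁻ x, min 1 (R x) ∂(Measure.pi fun _ => μ) := by gcongr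
    _ ≤ ∫⁻ x, δ * min 1 (R x) ∂(Measure.pi fun _ => μ) := lintegral_const_mul_le _ _
    _ ≤ ∫⁻ x, (f x + R x * g x) ∂(Measure.pi fun _ => μ) := by
        refine lintegral_mono fun x => ?_
        calc δ * min 1 (R x) ≤ (f x + g x) * min 1 (R x) := by gcongr; exact hδ x
          _ = f x * min 1 (R x) + g x * min 1 (R x) := add_mul _ _ _
          _ ≤ f x * 1 + g x * R x := by gcongr; exacts [min_le_left _ _, min_le_right _ _]
          _ = _ := by rw [mul_one, mul_comm]
    _ = _ := by
        rw [lintegral_add_left hf, pi_withDensity n μ hρ,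
          lintegral_withDensity_eq_lintegral_mul _ hRm hg]
        rfl

end LeCam

/-! ### Reduction from the hypercube to pairs of neighbours. -/

section Assouad

/-- Assouad's lemma. -/
theorem card_mul_le_two_mul_of_pairs {K : Type*} [Fintype K] [DecidableEq K]
    {R : (K → Bool) → ENNReal} {a : (K → Bool) → K → ENNReal} {D M : ENNReal}
    (hR : ∀ ε, ∑ k, a ε k ≤ R ε)
    (hpair : ∀ ε k, ε k = false → D ≤ a ε k + a (Function.update ε k true) k)
    (hM : ∀ ε, R ε ≤ M) : Fintype.card K * D ≤ 2 * M := by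
  let flip : K → (K → Bool) → (K → Bool) := fun k ε => Function.update ε k (!ε k)
  have hflip : ∀ k, Function.Involutive (flip k) := by
    intro k ε
    ext i
    by_cases h : i = k
    · subst h; simp [flip]
    · simp [flip, h]
  have hpair' : ∀ ε k, D ≤ a ε k + a (flip k ε) k := by
    intro ε k
    cases h : ε k with
    | false => simpa [flip, h] using hpair ε k h
    | true =>
      have h1 := hpair (flip k ε) k (by simp [flip, h])
      have h2 : Function.update (flip k ε) k true = ε := by
        simp only [flip, Function.update_idem]
        rw [← h, Function.update_eq_self]
      rw [h2] at h1
      rwa [add_comm]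
  -- Flipping coordinate `k` permutes the cube, so summing the pair bound over all `ε` counts every
  -- `a ε k` twice.
  have hsum : ∀ k, (2 ^ Fintype.card K : ℕ) * D ≤ 2 * ∑ ε, a ε k := by
    intro k
    have h1 : ∑ ε, a (flip k ε) k = ∑ ε, a ε k :=
      Equiv.sum_comp (hflip k).toPerm fun ε => a ε k
    calc ((2 ^ Fintype.card K : ℕ) : ENNReal) * D = ∑ _ : K → Bool, D := by
          rw [Finset.sum_const, Finset.card_univ, Fintype.card_fun, Fintype.card_bool, nsmul_eq_mul]
      _ ≤ ∑ ε, (a ε k + a (flip k ε) k) := Finset.sum_le_sum fun ε _ => hpair' ε k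
      _ = _ := by rw [Finset.sum_add_distrib, h1, two_mul]
  have h2 : ((2 ^ Fintype.card K : ℕ) : ENNReal) * (Fintype.card K * D)
      ≤ (2 ^ Fintype.card K : ℕ) * (2 * M) := by
    calc ((2 ^ Fintype.card K : ℕ) : ENNReal) * (Fintype.card K * D)
        = ∑ _ : K, ((2 ^ Fintype.card K : ℕ) : ENNReal) * D := by
          rw [Finset.sum_const, Finset.card_univ, nsmul_eq_mul]
          ring
      _ ≤ ∑ k, 2 * ∑ ε, a ε k := Finset.sum_le_sum fun k _ => hsum k
      _ = 2 * ∑ ε, ∑ k, a ε k := by rw [← Finset.mul_sum, Finset.sum_comm]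
      _ ≤ 2 * ∑ _ : K → Bool, M := by
          gcongr with ε
          exact (hR ε).trans (hM ε)
      _ = _ := by
          rw [Finset.sum_const, Finset.card_univ, Fintype.card_fun, Fintype.card_bool, nsmul_eq_mul]
          ring
  exact (ENNReal.mul_le_mul_iff_right (by positivity) (ENNReal.natCast_ne_top _)).1 h2

end Assouad

/-! ### Splitting the risk into local losses. -/

section Risk

variable {d : ℕ}

theorem isProbabilityMeasure_densityMeasure {p : EuclideanSpace ℝ (Fin d) → ℝ} (hp : IsDensity p) :
    IsProbabilityMeasure (densityMeasure p) := by
  refine ⟨?_⟩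
  rw [densityMeasure, withDensity_apply _ MeasurableSet.univ, Measure.restrict_univ,
    ← ofReal_integral_eq_lintegral_ofReal hp.1 (Filter.Eventually.of_forall hp.2.1), hp.2.2,
    ENNReal.ofReal_one]

/-- The unweighted loss of the estimator over the region `S`. -/
def localLoss {n : ℕ} (shat : (Fin n → EuclideanSpace ℝ (Fin d)) →
      EuclideanSpace ℝ (Fin d) → EuclideanSpace ℝ (Fin d))
    (p : EuclideanSpace ℝ (Fin d) → ℝ) (t : ℝ) (S : Set (EuclideanSpace ℝ (Fin d)))
    (X : Fin n → EuclideanSpace ℝ (Fin d)) : ENNReal :=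
  ∫⁻ x in S, ‖shat X x - score p t x‖ₑ ^ 2

variable {n : ℕ} {shat : (Fin n → EuclideanSpace ℝ (Fin d)) →
      EuclideanSpace ℝ (Fin d) → EuclideanSpace ℝ (Fin d)}

theorem measurable_localLoss (hs : Measurable (Function.uncurry shat)) {t : ℝ} (ht : 0 < t)
    {p : EuclideanSpace ℝ (Fin d) → ℝ} (hp : IsDensity p) (S : Set (EuclideanSpace ℝ (Fin d))) :
    Measurable (localLoss shat p t S) := by
  unfold localLoss
  have h : Measurable fun z : (Fin n → EuclideanSpace ℝ (Fin d)) × EuclideanSpace ℝ (Fin d) =>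
      ‖shat z.1 z.2 - score p t z.2‖ₑ ^ 2 :=
    ((hs.sub ((measurable_score ht hp).comp measurable_snd)).enorm).pow_const 2
  exact h.lintegral_prod_right'

/-- The weight `p_t` varies with the hypothesis. Replacing it by a common constant `w` makes local
losses under neighbouring hypotheses comparable. -/
theorem sum_localLoss_le_scoreRisk {K : Type*} [Fintype K]
    (hs : Measurable (Function.uncurry shat)) {t : ℝ} (ht : 0 < t)
    {p : EuclideanSpace ℝ (Fin d) → ℝ} (hp : IsDensity p) {S : K → Set (EuclideanSpace ℝ (Fin d))}
    (hS : ∀ k, MeasurableSet (S k)) (hd : Pairwise (Function.onFun Disjoint S)) {w : ℝ}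
    (hw : ∀ k, ∀ x ∈ S k, w ≤ diffusedDensity p t x) :
    ∑ k, ENNReal.ofReal w * ∫⁻ X, localLoss shat p t (S k) X
        ∂(Measure.pi fun _ : Fin n => densityMeasure p) ≤ scoreRisk shat p t := by
  unfold scoreRisk
  rw [← Finset.mul_sum, ← lintegral_finsetSum _ fun k _ => measurable_localLoss hs ht hp (S k),
    ← lintegral_const_mul _
      (Finset.measurable_fun_sum _ fun k _ => measurable_localLoss hs ht hp (S k))]
  refine lintegral_mono fun X => ?_
  calc ENNReal.ofReal w * ∑ k, localLoss shat p t (S k) X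
      = ∑ k, ∫⁻ x in S k, ENNReal.ofReal w * ‖shat X x - score p t x‖ₑ ^ 2 := by
        rw [Finset.mul_sum]
        refine Finset.sum_congr rfl fun k _ => ?_
        rw [localLoss, lintegral_const_mul' _ _ ENNReal.ofReal_ne_top]
    _ ≤ ∑ k, ∫⁻ x in S k, ‖shat X x - score p t x‖ₑ ^ 2 *
          ENNReal.ofReal (diffusedDensity p t x) := by
        refine Finset.sum_le_sum fun k _ => setLIntegral_mono' (hS k) fun x hx => ?_
        rw [mul_comm]
        gcongr
        exact hw k x hx
    _ = ∫⁻ x in ⋃ k, S k, ‖shat X x - score p t x‖ₑ ^ 2 *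
          ENNReal.ofReal (diffusedDensity p t x) := by
        rw [lintegral_iUnion hS hd, tsum_fintype]
    _ ≤ _ := setLIntegral_le_lintegral _ _

theorem enorm_sub_sq_le {V : Type*} [SeminormedAddCommGroup V] (a b c : V) :
    ‖b - c‖ₑ ^ 2 ≤ 2 * (‖a - c‖ₑ ^ 2 + ‖a - b‖ₑ ^ 2) := by
  have h : ‖b - c‖ₑ ≤ ‖a - c‖ₑ + ‖a - b‖ₑ := by
    rw [show b - c = (a - c) - (a - b) by abel]
    exact enorm_sub_le
  refine (pow_le_pow_left' h 2).trans ?_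
  simp only [enorm_eq_nnnorm]
  norm_cast
  rw [← NNReal.coe_le_coe]
  push_cast
  nlinarith [sq_nonneg (‖a - c‖ - ‖a - b‖)]

theorem lintegral_score_sub_le_localLoss (hs : Measurable (Function.uncurry shat)) {t : ℝ}
    (ht : 0 < t) {p q : EuclideanSpace ℝ (Fin d) → ℝ} (hp : IsDensity p)
    (S : Set (EuclideanSpace ℝ (Fin d))) (X : Fin n → EuclideanSpace ℝ (Fin d)) :
    (∫⁻ x in S, ‖score q t x - score p t x‖ₑ ^ 2) / 2 ≤
      localLoss shat p t S X + localLoss shat q t S X := by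
  refine ENNReal.div_le_of_le_mul' ?_
  unfold localLoss
  have hm : Measurable fun x => ‖shat X x - score p t x‖ₑ ^ 2 :=
    (((hs.comp (measurable_const.prodMk measurable_id)).sub
      (measurable_score ht hp)).enorm).pow_const 2
  rw [← lintegral_add_left hm, ← lintegral_const_mul' _ _ (by norm_num)]
  exact lintegral_mono fun x => enorm_sub_sq_le _ _ _

end Risk

/-! ### Stability of the Sobolev constraint under perturbation. -/

section Sobolev

variable {d : ℕ}

/-- The homogeneous Sobolev energy `∫ ‖ω‖^{2β} |F[f](ω)|² dω`. -/
def sobolevEnergy (β : ℝ) (f : EuclideanSpace ℝ (Fin d) → ℝ) : ENNReal :=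
  ∫⁻ ω, ENNReal.ofReal (‖ω‖ ^ (2 * β) * ‖fourierTransform f ω‖ ^ 2)

/-- Each coordinate is at most the norm. One isotropic energy therefore controls all multi-indices
`α` at once. -/
theorem prod_abs_rpow_sq_le {β : ℝ} {α : Fin d → ℝ} (hα : ∀ i, 0 ≤ α i) (hs : ∑ i, α i = β)
    (ω : EuclideanSpace ℝ (Fin d)) : (∏ i, |ω i| ^ α i) ^ 2 ≤ ‖ω‖ ^ (2 * β) := by
  have h1 : ∏ i, |ω i| ^ α i ≤ ∏ i, ‖ω‖ ^ α i := by
    refine Finset.prod_le_prod (fun i _ => by positivity) fun i _ => ?_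
    exact Real.rpow_le_rpow (abs_nonneg _) (PiLp.norm_apply_le ω i) (hα i)
  have h2 : ∏ i, ‖ω‖ ^ α i = ‖ω‖ ^ β := by
    rw [← hs, Real.rpow_sum_of_nonneg (norm_nonneg _) fun i _ => hα i]
  rw [h2] at h1
  calc (∏ i, |ω i| ^ α i) ^ 2 ≤ (‖ω‖ ^ β) ^ 2 := by
        gcongr
    _ = _ := by rw [← Real.rpow_natCast, ← Real.rpow_mul (norm_nonneg _)]; push_cast; ring_nf

theorem integrable_mul_cexp {f : EuclideanSpace ℝ (Fin d) → ℝ} (hf : Integrable f)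
    (ω : EuclideanSpace ℝ (Fin d)) :
    Integrable fun x => (f x : ℂ) * Complex.exp (-Complex.I * ((inner ℝ ω x : ℝ) : ℂ)) := by
  refine hf.ofReal.mul_bdd (c := 1) (Continuous.aestronglyMeasurable (by fun_prop)) ?_
  refine Filter.Eventually.of_forall fun x => ?_
  rw [Complex.norm_exp]
  simp

theorem fourierTransform_add {f g : EuclideanSpace ℝ (Fin d) → ℝ} (hf : Integrable f)
    (hg : Integrable g) (ω : EuclideanSpace ℝ (Fin d)) :
    fourierTransform (fun x => f x + g x) ω = fourierTransform f ω + fourierTransform g ω := by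
  unfold fourierTransform
  rw [← integral_add (integrable_mul_cexp hf ω) (integrable_mul_cexp hg ω)]
  congr 1
  ext x
  push_cast
  ring

theorem fourierTransform_const_mul (c : ℝ) (f : EuclideanSpace ℝ (Fin d) → ℝ)
    (ω : EuclideanSpace ℝ (Fin d)) :
    fourierTransform (fun x => c * f x) ω = c * fourierTransform f ω := by
  unfold fourierTransform
  rw [← integral_const_mul]
  congr 1
  ext x
  push_cast
  ring

theorem fourierTransform_congr_ae {f g : EuclideanSpace ℝ (Fin d) → ℝ} (h : f =ᵐ[volume] g) :
    fourierTransform f = fourierTransform g := by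
  ext ω
  refine integral_congr_ae ?_
  filter_upwards [h] with x hx
  rw [hx]

theorem sobolevEnergy_const_mul (β c : ℝ) (f : EuclideanSpace ℝ (Fin d) → ℝ) :
    sobolevEnergy β (fun x => c * f x) = ENNReal.ofReal (c ^ 2) * sobolevEnergy β f := by
  unfold sobolevEnergy
  rw [← lintegral_const_mul' _ _ ENNReal.ofReal_ne_top]
  congr 1
  ext ω
  rw [← ENNReal.ofReal_mul (sq_nonneg c), fourierTransform_const_mul, norm_mul, Complex.norm_real,
    mul_pow, Real.norm_eq_abs, sq_abs]
  congr 1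
  ring

theorem continuous_fourierTransform {f : EuclideanSpace ℝ (Fin d) → ℝ} (hf : Integrable f) :
    Continuous (fourierTransform f) := by
  refine continuous_of_dominated (fun ω => (integrable_mul_cexp hf ω).1)
    (bound := fun x => ‖f x‖) (fun ω => Filter.Eventually.of_forall fun x => ?_) hf.norm
    (Filter.Eventually.of_forall fun x => by fun_prop)
  rw [norm_mul, Complex.norm_exp]
  simp

/-- A perturbation of small Sobolev energy enlarges the Sobolev radius slightly. -/
theorem exists_sobolev_perturbation (d : ℕ) (β : ℝ) {L' L : ℝ} (hL' : 0 < L') (hL : L' < L) :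
    ∃ κ : ℝ, 0 < κ ∧ ∀ p f : EuclideanSpace ℝ (Fin d) → ℝ, Integrable p → Integrable f →
      sobolevEnergy β f ≤ ENNReal.ofReal κ →
      ∀ α : Fin d → ℝ, (∀ i, 0 ≤ α i) → ∑ i, α i = β →
      ∫⁻ ω : EuclideanSpace ℝ (Fin d),
        ENNReal.ofReal ((∏ i, |ω i| ^ α i) ^ 2 * ‖fourierTransform p ω‖ ^ 2)
        ≤ ENNReal.ofReal ((2 * Real.pi) ^ d * L' ^ 2) →
      ∫⁻ ω : EuclideanSpace ℝ (Fin d),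
        ENNReal.ofReal ((∏ i, |ω i| ^ α i) ^ 2 * ‖fourierTransform (fun x => p x + f x) ω‖ ^ 2)
        ≤ ENNReal.ofReal ((2 * Real.pi) ^ d * L ^ 2) := by
  set η := (L - L') / L' with hη
  have hη0 : 0 < η := div_pos (sub_pos.2 hL) hL'
  have hηL : 1 + η = L / L' := by rw [hη]; field_simp; ring
  -- In `(x + y)² ≤ (1 + η) x² + (1 + η⁻¹) y²` the choice `1 + η = L / L'` turns `L'²` into `L L'`,
  -- leaving `L² - L L'` for the perturbation.
  refine ⟨(2 * Real.pi) ^ d * (L ^ 2 - L * L') / (1 + η⁻¹), ?_, ?_⟩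
  · have : 0 < L ^ 2 - L * L' := by nlinarith
    positivity
  intro p f hp hf hfκ α hα hs hpα
  have hpt : ∀ ω : EuclideanSpace ℝ (Fin d),
      ENNReal.ofReal ((∏ i, |ω i| ^ α i) ^ 2 * ‖fourierTransform (fun x => p x + f x) ω‖ ^ 2) ≤
      ENNReal.ofReal (1 + η) *
        ENNReal.ofReal ((∏ i, |ω i| ^ α i) ^ 2 * ‖fourierTransform p ω‖ ^ 2) +
      ENNReal.ofReal (1 + η⁻¹) * ENNReal.ofReal (‖ω‖ ^ (2 * β) * ‖fourierTransform f ω‖ ^ 2) := by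
    intro ω
    rw [← ENNReal.ofReal_mul (by positivity), ← ENNReal.ofReal_mul (by positivity),
      ← ENNReal.ofReal_add (by positivity) (by positivity)]
    refine ENNReal.ofReal_le_ofReal ?_
    rw [fourierTransform_add hp hf]
    have h1 := norm_add_le (fourierTransform p ω) (fourierTransform f ω)
    set x := ‖fourierTransform p ω‖
    set y := ‖fourierTransform f ω‖
    have h2 : ‖fourierTransform p ω + fourierTransform f ω‖ ^ 2
        ≤ (1 + η) * x ^ 2 + (1 + η⁻¹) * y ^ 2 := by
      have h3 : (x + y) ^ 2 ≤ (1 + η) * x ^ 2 + (1 + η⁻¹) * y ^ 2 := by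
        have h4 : (1 + η) * x ^ 2 + (1 + η⁻¹) * y ^ 2 - (x + y) ^ 2 = η⁻¹ * (η * x - y) ^ 2 := by
          field_simp
          ring
        have : 0 ≤ η⁻¹ * (η * x - y) ^ 2 := by positivity
        linarith
      exact (pow_le_pow_left₀ (norm_nonneg _) h1 2).trans h3
    have h5 := prod_abs_rpow_sq_le hα hs ω
    calc (∏ i, |ω i| ^ α i) ^ 2 * ‖fourierTransform p ω + fourierTransform f ω‖ ^ 2
        ≤ (∏ i, |ω i| ^ α i) ^ 2 * ((1 + η) * x ^ 2 + (1 + η⁻¹) * y ^ 2) := by gcongr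
      _ = (1 + η) * ((∏ i, |ω i| ^ α i) ^ 2 * x ^ 2) +
            (1 + η⁻¹) * ((∏ i, |ω i| ^ α i) ^ 2 * y ^ 2) := by ring
      _ ≤ _ := by gcongr
  refine (lintegral_mono hpt).trans ?_
  rw [lintegral_add_right', lintegral_const_mul' _ _ ENNReal.ofReal_ne_top,
    lintegral_const_mul' _ _ ENNReal.ofReal_ne_top]
  · refine (add_le_add (mul_le_mul_right hpα _) (mul_le_mul_right hfκ _)).trans ?_
    have : 0 < L ^ 2 - L * L' := by nlinarith
    rw [← ENNReal.ofReal_mul (by positivity), ← ENNReal.ofReal_mul (by positivity),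
      ← ENNReal.ofReal_add (by positivity) (by positivity)]
    refine ENNReal.ofReal_le_ofReal (le_of_eq ?_)
    rw [mul_div_cancel₀ _ (by positivity), hηL]
    field_simp
    ring
  · refine (Measurable.aemeasurable ?_)
    have := (continuous_fourierTransform hf).measurable
    fun_prop

end Sobolev

/-! ### The base density, nondegeneracy, and admissible perturbations. -/

section Base

variable {d : ℕ}

theorem le_mul_exp_of_support {f : EuclideanSpace ℝ (Fin d) → ℝ} {F R γ c : ℝ} (hF : 0 ≤ F)
    (hγ : 0 < γ) (hc : 0 < c) (hf : ∀ x, f x ≤ F) (hR : ∀ x, R ≤ ‖x‖ → f x = 0)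
    (x : EuclideanSpace ℝ (Fin d)) :
    f x ≤ F * Real.exp (c * R ^ γ) * Real.exp (-c * ‖x‖ ^ γ) := by
  rcases le_total R ‖x‖ with h | h
  · rw [hR x h]; positivity
  · rw [mul_assoc, ← Real.exp_add]
    refine (hf x).trans (le_mul_of_one_le_right hF (Real.one_le_exp ?_))
    have := Real.rpow_le_rpow (norm_nonneg x) h hγ.le
    nlinarith

/-- A smooth compactly supported density which is positive on a ball of radius `R`. -/
theorem exists_bump_density (d : ℕ) {β R : ℝ} (hβ : 0 < β) (hR : 0 < R) :
    ∃ q : EuclideanSpace ℝ (Fin d) → ℝ, Measurable q ∧ IsDensity q ∧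
      (∃ F, 0 ≤ F ∧ ∀ x, q x ≤ F) ∧ (∀ x, R + 1 ≤ ‖x‖ → q x = 0) ∧
      (∃ m, 0 < m ∧ ∀ x ∈ Metric.ball (0 : EuclideanSpace ℝ (Fin d)) R, m ≤ q x) ∧
      ∃ C, 0 < C ∧ ∀ h : ℝ, 0 < h →
        sobolevEnergy β (fun y => q (h⁻¹ • y)) ≤ ENNReal.ofReal (C * h ^ ((d : ℝ) - 2 * β)) := by
  let b : ContDiffBump (0 : EuclideanSpace ℝ (Fin d)) := ⟨R, R + 1, hR, by linarith⟩
  have hI := b.integral_pos (μ := volume)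
  have hq : ∀ x, b.normed volume x = b x / ∫ x, b x := fun x => b.normed_def x
  refine ⟨b.normed volume, b.continuous_normed.measurable,
    ⟨b.integrable_normed, b.nonneg_normed, b.integral_normed⟩,
    ⟨1 / ∫ x, b x, by positivity, fun x => ?_⟩, fun x hx => ?_,
    ⟨1 / ∫ x, b x, by positivity, fun x hx => ?_⟩, ?_⟩
  · rw [hq]
    have := b.le_one (x := x)
    gcongr
  · rw [hq, b.zero_of_le_dist (by rw [dist_zero_right]; exact hx), zero_div]
  · rw [hq, b.one_of_mem_closedBall (Metric.ball_subset_closedBall hx)]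
  · obtain ⟨C, hC, h⟩ := exists_sobolev_bound hβ (b.contDiff_normed (μ := volume)
      (n := ⊤)) b.hasCompactSupport_normed (b.tsupport_normed_eq (μ := volume)).subset
    refine ⟨C, hC, fun s hs => ?_⟩
    have := h Unit {()} 0 1 s hs (by simp) (by simp)
    simpa [sobolevEnergy] using this

/-- Members of the class are only almost everywhere measurable, while the likelihood ratios below
use a measurable base density. Truncating a measurable version restores the pointwise bounds, and
the Fourier transform ignores null sets. -/
theorem exists_measurable_mem {γ c C β L : ℝ} {p : EuclideanSpace ℝ (Fin d) → ℝ}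
    (hp : p ∈ expTailClass d γ c C ∩ sobolevClass d β L) :
    ∃ q, Measurable q ∧ q ∈ expTailClass d γ c C ∩ sobolevClass d β L := by
  obtain ⟨⟨hd, ht⟩, _, hs⟩ := hp
  have hm := hd.1.1.aemeasurable
  let q : EuclideanSpace ℝ (Fin d) → ℝ := fun x =>
    min (max (hm.mk p x) 0) (C * Real.exp (-c * ‖x‖ ^ γ))
  have hnonneg : ∀ x : EuclideanSpace ℝ (Fin d), 0 ≤ C * Real.exp (-c * ‖x‖ ^ γ) :=
    fun x => (hd.2.1 x).trans (ht x)
  have hqm : Measurable q := by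
    have h1 : Measurable fun x : EuclideanSpace ℝ (Fin d) => C * Real.exp (-c * ‖x‖ ^ γ) := by
      fun_prop
    exact (hm.measurable_mk.max measurable_const).min h1
  have hae : p =ᵐ[volume] q := by
    filter_upwards [hm.ae_eq_mk] with x hx
    simp only [q]
    rw [← hx, max_eq_left (hd.2.1 x), min_eq_left (ht x)]
  have hqd : IsDensity q := by
    refine ⟨hd.1.congr hae, fun x => le_min (le_max_right _ _) (hnonneg x), ?_⟩
    rw [← integral_congr_ae hae, hd.2.2]
  refine ⟨q, hqm, ⟨hqd, fun x => min_le_right _ _⟩, hqd, ?_⟩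
  rwa [← fourierTransform_congr_ae hae]

/-- A nondegenerate class contains, with some room to spare, a density which is bounded below on a
given ball. -/
theorem Nondegenerate.exists_base {γ c C β L R : ℝ} (hγ : 0 < γ) (hc : 0 < c) (hβ : 0 < β)
    (hR : 0 < R) (h : Nondegenerate d γ c C β L) :
    ∃ C' L' m : ℝ, 0 < C' ∧ C' < C ∧ 0 < L' ∧ L' < L ∧ 0 < m ∧
      ∃ p : EuclideanSpace ℝ (Fin d) → ℝ, Measurable p ∧
        p ∈ expTailClass d γ c C' ∩ sobolevClass d β L' ∧
        ∀ x ∈ Metric.ball (0 : EuclideanSpace ℝ (Fin d)) R, m ≤ p x := by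
  obtain ⟨C', L', hC', hCC, hL', hLL, p₀, hp₀⟩ := h
  obtain ⟨p, hpm, ⟨hpd, hpt⟩, -, hps⟩ := exists_measurable_mem hp₀
  obtain ⟨q, hqm, hqd, ⟨F, hF, hqF⟩, hq0, ⟨m, hm, hqm'⟩, B, hB, hqB⟩ :=
    exists_bump_density d hβ hR
  obtain ⟨κ, hκ, hpert⟩ := exists_sobolev_perturbation d β hL'
    (show L' < (L' + L) / 2 by linarith)
  set G := F * Real.exp (c * (R + 1) ^ γ) with hG
  have hG0 : 0 ≤ G := by positivity
  have hqG := le_mul_exp_of_support hF hγ hc hqF hq0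
  have hqB1 : sobolevEnergy β q ≤ ENNReal.ofReal B := by simpa using hqB 1 one_pos
  -- `l` is the weight of the bump density in the mixture: it may use half of the slack in the tail
  -- constant and the Sobolev allowance `κ`. The other part `(1 - l) p` only shrinks.
  obtain ⟨l, hl0, hl1, hlG, hlB⟩ : ∃ l : ℝ, 0 < l ∧ l ≤ 1 ∧ l * G ≤ (C - C') / 2 ∧
      l ^ 2 * B ≤ κ := by
    refine ⟨min 1 (min ((C - C') / 2 / (G + 1)) (κ / B)), ?_, min_le_left _ _, ?_, ?_⟩
    · have : 0 < C - C' := by linarith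
      positivity
    · have h1 : min 1 (min ((C - C') / 2 / (G + 1)) (κ / B)) ≤ (C - C') / 2 / (G + 1) :=
        (min_le_right _ _).trans (min_le_left _ _)
      calc _ ≤ (C - C') / 2 / (G + 1) * (G + 1) := by
            have : 0 < C - C' := by linarith
            gcongr
            linarith
        _ = _ := by field_simp
    · set l := min 1 (min ((C - C') / 2 / (G + 1)) (κ / B))
      have h0 : 0 ≤ l := by
        have : 0 < C - C' := by linarith
        positivity
      have h1 : l ≤ κ / B := (min_le_right _ _).trans (min_le_right _ _)
      have h2 : l ≤ 1 := min_le_left _ _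
      calc l ^ 2 * B ≤ l * B := by gcongr; nlinarith
        _ ≤ κ / B * B := by gcongr
        _ = κ := by field_simp
  have hi1 : Integrable fun x => (1 - l) * p x := hpd.1.const_mul _
  have hi2 : Integrable fun x => l * q x := hqd.1.const_mul _
  have hd : IsDensity fun x => (1 - l) * p x + l * q x := by
    refine ⟨hi1.add hi2, fun x => ?_, ?_⟩
    · have := hpd.2.1 x
      have := hqd.2.1 x
      have : 0 ≤ 1 - l := by linarith
      positivity
    · rw [integral_add hi1 hi2, integral_const_mul, integral_const_mul, hpd.2.2, hqd.2.2]
      ring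
  refine ⟨(C' + C) / 2, (L' + L) / 2, l * m, by linarith, by linarith, by linarith, by linarith,
    by positivity, fun x => (1 - l) * p x + l * q x, by fun_prop, ⟨⟨hd, fun x => ?_⟩, hd, ?_⟩,
    fun x hx => ?_⟩
  · have h1 := hqG x
    have h2 := hpt x
    have h3 : (1 - l) * p x ≤ C' * Real.exp (-c * ‖x‖ ^ γ) := by
      have := hpd.2.1 x
      nlinarith
    have h4 : l * q x ≤ (C - C') / 2 * Real.exp (-c * ‖x‖ ^ γ) := by
      calc l * q x ≤ l * (G * Real.exp (-c * ‖x‖ ^ γ)) := by gcongr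
        _ = l * G * Real.exp (-c * ‖x‖ ^ γ) := by ring
        _ ≤ _ := by gcongr
    calc _ ≤ C' * Real.exp (-c * ‖x‖ ^ γ) + (C - C') / 2 * Real.exp (-c * ‖x‖ ^ γ) :=
          add_le_add h3 h4
      _ = _ := by ring
  · intro α hα hs
    refine hpert _ _ hi1 hi2 ?_ α hα hs ((lintegral_mono fun ω => ?_).trans (hps α hα hs))
    · rw [sobolevEnergy_const_mul]
      calc _ ≤ ENNReal.ofReal (l ^ 2) * ENNReal.ofReal B := by gcongr
        _ = ENNReal.ofReal (l ^ 2 * B) := (ENNReal.ofReal_mul (by positivity)).symm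
        _ ≤ _ := ENNReal.ofReal_le_ofReal hlB
    · refine ENNReal.ofReal_le_ofReal ?_
      rw [fourierTransform_const_mul, norm_mul, Complex.norm_real,
        Real.norm_of_nonneg (by linarith)]
      gcongr
      exact mul_le_of_le_one_left (norm_nonneg _) (by linarith)
  · have h1 := hqm' x hx
    have h2 : 0 ≤ (1 - l) * p x := mul_nonneg (by linarith) (hpd.2.1 x)
    nlinarith

/-- Dilating a smooth compactly supported density by `h` multiplies the bound for its Sobolev energy
by `h^(-(d+2β))`, which can be made as small as desired. Compact support gives the tail bound once
`C` is large. Here `h` is chosen to reach radius `L / 2`. -/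
theorem exists_nondegenerate (d : ℕ) {γ c β L : ℝ} (hγ : 0 < γ) (hc : 0 < c) (hβ : 0 < β)
    (hL : 0 < L) : ∃ C₀ : ℝ, ∀ C : ℝ, C₀ ≤ C → Nondegenerate d γ c C β L := by
  obtain ⟨q, hqm, hqd, ⟨F, hF, hqF⟩, hq0, -, B, hB, hqB⟩ := exists_bump_density d hβ one_pos
  have hdβ : 0 < (d : ℝ) + 2 * β := by positivity
  obtain ⟨h, hh, hhB⟩ : ∃ h : ℝ, 0 < h ∧
      B * h ^ (-((d : ℝ) + 2 * β)) = (2 * Real.pi) ^ d * (L / 2) ^ 2 := by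
    refine ⟨((2 * Real.pi) ^ d * (L / 2) ^ 2 / B) ^ (-((d : ℝ) + 2 * β)⁻¹), by positivity, ?_⟩
    rw [← Real.rpow_mul (by positivity), neg_mul_neg, inv_mul_cancel₀ hdβ.ne', Real.rpow_one]
    field_simp
  set f : EuclideanSpace ℝ (Fin d) → ℝ := fun y => (h ^ d)⁻¹ * q (h⁻¹ • y) with hf
  have hfi : Integrable f := (hqd.1.comp_smul (inv_ne_zero hh.ne')).const_mul _
  have hfd : IsDensity f := by
    refine ⟨hfi, fun x => mul_nonneg (by positivity) (hqd.2.1 _), ?_⟩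
    rw [hf, integral_const_mul]
    have := integral_comp_inv_smul_sub q hh 0
    simp only [sub_zero] at this
    rw [this, hqd.2.2, mul_one, inv_mul_cancel₀ (by positivity)]
  have hft := le_mul_exp_of_support (f := f) (F := (h ^ d)⁻¹ * F) (R := h * 2) (by positivity) hγ hc
    (fun x => by simp only [hf]; gcongr; exact hqF _) (fun x hx => by
      simp only [hf]
      rw [hq0, mul_zero]
      rw [norm_smul, Real.norm_of_nonneg (by positivity), inv_mul_eq_div, le_div_iff₀ hh]
      linarith)
  set G := (h ^ d)⁻¹ * F * Real.exp (c * (h * 2) ^ γ)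
  have hG : 0 ≤ G := by positivity
  refine ⟨G + 2, fun C hC => ⟨G + 1, L / 2, by positivity, by linarith, by positivity, by linarith,
    f, ⟨hfd, fun x => (hft x).trans ?_⟩, hfd, fun α hα hs => ?_⟩⟩
  · gcongr
    linarith
  · calc _ ≤ sobolevEnergy β f := lintegral_mono fun ω => ENNReal.ofReal_le_ofReal (by
          gcongr
          exact prod_abs_rpow_sq_le hα hs ω)
      _ ≤ ENNReal.ofReal ((h ^ d)⁻¹ ^ 2) * ENNReal.ofReal (B * h ^ ((d : ℝ) - 2 * β)) := by
          rw [hf, sobolevEnergy_const_mul]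
          gcongr
          exact hqB h hh
      _ = ENNReal.ofReal ((h ^ d)⁻¹ ^ 2 * (B * h ^ ((d : ℝ) - 2 * β))) :=
          (ENNReal.ofReal_mul (by positivity)).symm
      _ = _ := by
          congr 1
          rw [← hhB, neg_add, Real.rpow_add hh, Real.rpow_sub hh, Real.rpow_neg hh.le,
            Real.rpow_neg hh.le, Real.rpow_natCast]
          field_simp

/-- Bounded perturbations of mean zero which are supported in a ball where the density is bounded
below stay in the class. -/
theorem exists_perturbation_mem {γ c C C' β L L' m R : ℝ} (hγ : 0 < γ) (hc : 0 < c)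
    (hCC : C' < C) (hL' : 0 < L') (hLL : L' < L) (hm : 0 < m)
    {p : EuclideanSpace ℝ (Fin d) → ℝ} (hp : p ∈ expTailClass d γ c C' ∩ sobolevClass d β L')
    (hpm : ∀ x ∈ Metric.ball (0 : EuclideanSpace ℝ (Fin d)) R, m ≤ p x) :
    ∃ A₀ κ : ℝ, 0 < A₀ ∧ 0 < κ ∧ ∀ (S : EuclideanSpace ℝ (Fin d) → ℝ) (A : ℝ), 0 ≤ A → A ≤ A₀ →
      Integrable S → ∫ x, S x = 0 → (∀ x, |S x| ≤ 1) → (∀ x, R ≤ ‖x‖ → S x = 0) →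
      ENNReal.ofReal (A ^ 2) * sobolevEnergy β S ≤ ENNReal.ofReal κ →
      (fun x => p x + A * S x) ∈ expTailClass d γ c C ∩ sobolevClass d β L ∧
      ∀ x ∈ Metric.ball (0 : EuclideanSpace ℝ (Fin d)) R, m / 2 ≤ p x + A * S x := by
  obtain ⟨⟨hpd, hpt⟩, -, hps⟩ := hp
  obtain ⟨κ, hκ, hpert⟩ := exists_sobolev_perturbation d β hL' hLL
  have hCC' : 0 < C - C' := by linarith
  -- The first bound on `A` keeps the density above `m / 2` on the ball. The second fits the
  -- perturbation, supported in that ball, into the gap between the two tail bounds.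
  refine ⟨min (m / 2) ((C - C') * Real.exp (-c * R ^ γ)), κ, by positivity, hκ, ?_⟩
  intro S A hA hA₀ hSi hS0 hS1 hSR hSκ
  have hAm : A ≤ m / 2 := hA₀.trans (min_le_left _ _)
  have hAC : A ≤ (C - C') * Real.exp (-c * R ^ γ) := hA₀.trans (min_le_right _ _)
  have hi : Integrable fun x => A * S x := hSi.const_mul A
  have hAS : ∀ x, |A * S x| ≤ A := fun x => by
    rw [abs_mul, abs_of_nonneg hA]
    exact mul_le_of_le_one_right hA (hS1 x)
  have hlow : ∀ x ∈ Metric.ball (0 : EuclideanSpace ℝ (Fin d)) R, m / 2 ≤ p x + A * S x := by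
    intro x hx
    have h1 := hpm x hx
    have h2 := (abs_le.1 (hAS x)).1
    linarith
  have hd : IsDensity fun x => p x + A * S x := by
    refine ⟨hpd.1.add hi, fun x => ?_, ?_⟩
    · rcases lt_or_ge ‖x‖ R with h | h
      · exact (half_pos hm).le.trans (hlow x (mem_ball_zero_iff.2 h))
      · simp only
        rw [hSR x h, mul_zero, add_zero]
        exact hpd.2.1 x
    · rw [integral_add hpd.1 hi, integral_const_mul, hS0, mul_zero, add_zero, hpd.2.2]
  refine ⟨⟨⟨hd, fun x => ?_⟩, hd, fun α hα hs => ?_⟩, hlow⟩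
  · have h1 := le_mul_exp_of_support (f := fun x => A * S x) (F := A) hA hγ hc
      (fun x => (abs_le.1 (hAS x)).2) (fun x hx => by rw [hSR x hx, mul_zero]) x
    have h2 : A * Real.exp (c * R ^ γ) ≤ C - C' := by
      calc _ ≤ (C - C') * Real.exp (-c * R ^ γ) * Real.exp (c * R ^ γ) := by gcongr
        _ = C - C' := by rw [mul_assoc, ← Real.exp_add]; simp
    calc p x + A * S x ≤ C' * Real.exp (-c * ‖x‖ ^ γ) + (C - C') * Real.exp (-c * ‖x‖ ^ γ) := by
          refine add_le_add (hpt x) (h1.trans ?_)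
          gcongr
      _ = _ := by ring
  · refine hpert p _ hpd.1 hi ?_ α hα hs (hps α hα hs)
    rwa [sobolevEnergy_const_mul]

end Base

/-! ### Chi-square divergence of a perturbed density. -/

section ChiSquare

variable {d : ℕ}

/-- The likelihood ratio of `p + A f` to `p`, and its second moment. -/
theorem exists_density_ratio {p f : EuclideanSpace ℝ (Fin d) → ℝ} {A m : ℝ} (hm : 0 < m)
    (hpm : Measurable p) (hp : IsDensity p) (hq : IsDensity fun x => p x + A * f x)
    (hfm : Measurable f) (hfi : Integrable f) (hf0 : ∫ x, f x = 0)
    (hf2 : Integrable fun x => f x ^ 2) (hpf : ∀ x, f x ≠ 0 → m ≤ p x) :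
    ∃ ρ : EuclideanSpace ℝ (Fin d) → ENNReal, Measurable ρ ∧
      densityMeasure (fun x => p x + A * f x) = (densityMeasure p).withDensity ρ ∧
      ∫⁻ x, ρ x ^ 2 ∂(densityMeasure p) ≤ 1 + ENNReal.ofReal (A ^ 2 / m * ∫ x, f x ^ 2) := by
  have hρm : Measurable fun x => ENNReal.ofReal (1 + A * f x / p x) := by fun_prop
  have hpm' : Measurable fun x => ENNReal.ofReal (p x) := by fun_prop
  have hratio : ∀ x, 0 ≤ 1 + A * f x / p x := by
    intro x
    by_cases hf : f x = 0
    · simp [hf]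
    · have h1 : 0 < p x := hm.trans_le (hpf x hf)
      have h2 : 1 + A * f x / p x = (p x + A * f x) / p x := by field_simp
      rw [h2]
      exact div_nonneg (hq.2.1 x) h1.le
  refine ⟨fun x => ENNReal.ofReal (1 + A * f x / p x), hρm, ?_, ?_⟩
  · rw [densityMeasure, densityMeasure, ← withDensity_mul _ hpm' hρm]
    congr 1
    ext x
    rw [Pi.mul_apply, ← ENNReal.ofReal_mul (hp.2.1 x)]
    by_cases hf : f x = 0
    · simp [hf]
    · have h1 : 0 < p x := hm.trans_le (hpf x hf)
      congr 1
      field_simp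
  · rw [densityMeasure, lintegral_withDensity_eq_lintegral_mul _ hpm' (hρm.pow_const 2)]
    -- Expanding `p (1 + A f / p)²` leaves `p + 2 A f + A² f² / p`. The linear term integrates to
    -- zero. Where `f = 0` the ratio is `1`, even if `p` vanishes there.
    have hle : ∀ x, ((fun x => ENNReal.ofReal (p x)) *
        fun x => ENNReal.ofReal (1 + A * f x / p x) ^ 2) x
        ≤ ENNReal.ofReal (p x + 2 * A * f x + A ^ 2 / m * f x ^ 2) := by
      intro x
      rw [Pi.mul_apply, ← ENNReal.ofReal_pow (hratio x), ← ENNReal.ofReal_mul (hp.2.1 x)]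
      refine ENNReal.ofReal_le_ofReal ?_
      by_cases hf : f x = 0
      · simp [hf]
      · have h0 := hpf x hf
        have h1 : 0 < p x := hm.trans_le h0
        have h2 : p x * (1 + A * f x / p x) ^ 2 = p x + 2 * A * f x + A ^ 2 * f x ^ 2 / p x := by
          field_simp
          ring
        rw [h2, div_mul_eq_mul_div]
        gcongr
    refine (lintegral_mono hle).trans ?_
    have hi1 : Integrable fun x => p x + 2 * A * f x := hp.1.add (hfi.const_mul _)
    have hi2 : Integrable fun x => A ^ 2 / m * f x ^ 2 := hf2.const_mul _
    have hi : Integrable fun x => p x + 2 * A * f x + A ^ 2 / m * f x ^ 2 := hi1.add hi2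
    rw [← ofReal_integral_eq_lintegral_ofReal hi]
    · rw [integral_add hi1 hi2, integral_add hp.1 (hfi.const_mul _), integral_const_mul,
        integral_const_mul, hp.2.2, hf0, mul_zero, add_zero,
        ENNReal.ofReal_add zero_le_one (mul_nonneg (by positivity)
          (integral_nonneg fun x => sq_nonneg _)), ENNReal.ofReal_one]
    · refine Filter.Eventually.of_forall fun x => ?_
      by_cases hf : f x = 0
      · simpa [hf] using hp.2.1 x
      · have h0 := hpf x hf
        have h1 : 0 < p x := hm.trans_le h0
        have h2 : p x * (1 + A * f x / p x) ^ 2 = p x + 2 * A * f x + A ^ 2 * f x ^ 2 / p x := by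
          field_simp
          ring
        have h3 : 0 ≤ p x * (1 + A * f x / p x) ^ 2 := by positivity
        have h4 : A ^ 2 * f x ^ 2 / p x ≤ A ^ 2 / m * f x ^ 2 := by
          rw [div_mul_eq_mul_div]
          gcongr
        simp only [Pi.zero_apply]
        linarith

end ChiSquare

/-! ### The grid of bumps. -/

section Grid

variable {d M : ℕ}

/-- The points of `ℝ^d` with coordinates in `{0, 8, …, 8 (M - 1)}`. -/
def gridPoint (k : Fin d → Fin M) : EuclideanSpace ℝ (Fin d) :=
  WithLp.toLp 2 fun i => 8 * ((k i : ℕ) : ℝ)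

/-- Spacing `8` serves two purposes: bumps of radius `3/2` have disjoint supports, and for `h = √t`
the regions of radius `3√t` are disjoint. -/
theorem le_dist_gridPoint {j k : Fin d → Fin M} (h : j ≠ k) :
    8 ≤ dist (gridPoint j) (gridPoint k) := by
  obtain ⟨i, hi⟩ := Function.ne_iff.1 h
  rw [dist_eq_norm]
  refine le_trans ?_ (PiLp.norm_apply_le _ i)
  have h1 : (gridPoint j - gridPoint k) i = 8 * (((j i : ℕ) : ℝ) - ((k i : ℕ) : ℝ)) := by
    simp [gridPoint, mul_sub]
  rw [h1, norm_mul, Real.norm_of_nonneg (by norm_num)]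
  have h2 : (1 : ℝ) ≤ ‖((j i : ℕ) : ℝ) - ((k i : ℕ) : ℝ)‖ := by
    have h3 : ((j i : ℕ) : ℤ) - ((k i : ℕ) : ℤ) ≠ 0 := by
      intro h4
      apply hi
      ext
      omega
    have h5 := Int.one_le_abs h3
    rw [Real.norm_eq_abs]
    exact_mod_cast h5
  linarith

theorem norm_gridPoint_le (k : Fin d → Fin M) : ‖gridPoint k‖ ≤ 8 * d * M := by
  have h := (EuclideanSpace.basisFun (Fin d) ℝ).sum_repr (gridPoint k)
  rw [← h]
  refine (norm_sum_le _ _).trans ?_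
  calc _ ≤ ∑ _ : Fin d, (8 * M : ℝ) := by
        refine Finset.sum_le_sum fun i _ => ?_
        rw [norm_smul, OrthonormalBasis.norm_eq_one, mul_one]
        simp only [EuclideanSpace.basisFun_repr, gridPoint]
        rw [Real.norm_of_nonneg (by positivity)]
        gcongr
        exact (k i).2.le
    _ = _ := by simp; ring

variable {b : ContDiffBump (0 : EuclideanSpace ℝ (Fin d))} {e : EuclideanSpace ℝ (Fin d)}

/-- The sum of the odd bumps of width `h` at the grid points which are selected by `ε`. -/
def gridBump (b : ContDiffBump (0 : EuclideanSpace ℝ (Fin d))) (e : EuclideanSpace ℝ (Fin d))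
    (h : ℝ) (ε : (Fin d → Fin M) → Bool) (y : EuclideanSpace ℝ (Fin d)) : ℝ :=
  ∑ k, (if ε k then 1 else 0) * oddBump b e (h⁻¹ • y - gridPoint k)

theorem gridBump_update (h : ℝ) {ε : (Fin d → Fin M) → Bool} {k : Fin d → Fin M}
    (hk : ε k = false) (y : EuclideanSpace ℝ (Fin d)) :
    gridBump b e h (Function.update ε k true) y
      = gridBump b e h ε y + oddBump b e (h⁻¹ • y - gridPoint k) := by
  unfold gridBump
  rw [← Finset.add_sum_erase _ _ (Finset.mem_univ k),
    ← Finset.add_sum_erase Finset.univ (fun k => (if ε k then (1 : ℝ) else 0) * _)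
      (Finset.mem_univ k)]
  have : ∀ j ∈ Finset.univ.erase k,
      (if Function.update ε k true j then (1 : ℝ) else 0) * oddBump b e (h⁻¹ • y - gridPoint j)
      = (if ε j then (1 : ℝ) else 0) * oddBump b e (h⁻¹ • y - gridPoint j) := by
    intro j hj
    rw [Function.update_of_ne (Finset.ne_of_mem_erase hj)]
  rw [Finset.sum_congr rfl this]
  simp [hk]
  ring

theorem integrable_gridBump {h : ℝ} (hh : 0 < h) (ε : (Fin d → Fin M) → Bool) :
    Integrable (gridBump b e h ε) := by
  unfold gridBump
  exact integrable_finsetSum _ fun k _ =>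
    (integrable_comp_inv_smul_sub integrable_oddBump hh _).const_mul _

theorem continuous_oddBump : Continuous (oddBump b e) :=
  (contDiff_oddBump (n := 0)).continuous

theorem continuous_gridBump (h : ℝ) (ε : (Fin d → Fin M) → Bool) :
    Continuous (gridBump b e h ε) := by
  unfold gridBump
  exact continuous_finsetSum _ fun k _ => continuous_const.mul
    (continuous_oddBump.comp (by fun_prop))

theorem integral_gridBump {h : ℝ} (hh : 0 < h) (ε : (Fin d → Fin M) → Bool) :
    ∫ y, gridBump b e h ε y = 0 := by
  unfold gridBump
  rw [integral_finsetSum _ fun k _ =>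
    (integrable_comp_inv_smul_sub integrable_oddBump hh _).const_mul _]
  refine Finset.sum_eq_zero fun k _ => ?_
  rw [integral_const_mul, integral_comp_inv_smul_sub _ hh, integral_oddBump, mul_zero, mul_zero]

theorem abs_gridBump_le (hb : b.rOut = 1 / 2) (he : ‖e‖ = 1) (h : ℝ)
    (ε : (Fin d → Fin M) → Bool) (y : EuclideanSpace ℝ (Fin d)) :
    |gridBump b e h ε y| ≤ 1 := by
  unfold gridBump
  by_cases hy : ∃ k : Fin d → Fin M, ‖h⁻¹ • y - gridPoint k‖ < 3 / 2
  · obtain ⟨k, hk⟩ := hy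
    rw [Finset.sum_eq_single_of_mem k (Finset.mem_univ k)]
    · rw [abs_mul]
      refine mul_le_one₀ ?_ (abs_nonneg _) (abs_oddBump_le _)
      split_ifs <;> simp
    · intro j _ hjk
      rw [oddBump_eq_zero hb he, mul_zero]
      have h1 := le_dist_gridPoint hjk
      have h2 := dist_triangle_left (gridPoint j) (gridPoint k) (h⁻¹ • y)
      rw [dist_eq_norm (h⁻¹ • y), dist_eq_norm (h⁻¹ • y)] at h2
      linarith
  · push Not at hy
    rw [Finset.sum_eq_zero fun k _ => by rw [oddBump_eq_zero hb he (hy k), mul_zero]]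
    simp

theorem norm_sub_lt_of_oddBump_ne_zero (hb : b.rOut = 1 / 2) (he : ‖e‖ = 1) {h : ℝ} (hh : 0 < h)
    {z y : EuclideanSpace ℝ (Fin d)} (hy : oddBump b e (h⁻¹ • y - z) ≠ 0) :
    ‖y - h • z‖ < h * (3 / 2) := by
  have h1 : ‖h⁻¹ • y - z‖ < 3 / 2 := by
    by_contra h2
    exact hy (oddBump_eq_zero hb he (not_lt.1 h2))
  have h2 : y - h • z = h • (h⁻¹ • y - z) := by
    rw [smul_sub, smul_smul, mul_inv_cancel₀ hh.ne', one_smul]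
  rw [h2, norm_smul, Real.norm_of_nonneg hh.le]
  gcongr

theorem gridBump_eq_zero (hb : b.rOut = 1 / 2) (he : ‖e‖ = 1) {h τ : ℝ} (hh : 0 < h)
    (hτ : h ≤ τ) (hM : M * h ≤ τ) (ε : (Fin d → Fin M) → Bool) {y : EuclideanSpace ℝ (Fin d)}
    (hy : 8 * d * τ + 2 * τ ≤ ‖y‖) : gridBump b e h ε y = 0 := by
  refine Finset.sum_eq_zero fun k _ => ?_
  by_contra hne
  have h1 := norm_sub_lt_of_oddBump_ne_zero hb he hh (right_ne_zero_of_mul hne)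
  have h2 : ‖h • gridPoint k‖ ≤ 8 * d * τ := by
    rw [norm_smul, Real.norm_of_nonneg hh.le]
    calc h * ‖gridPoint k‖ ≤ h * (8 * d * M) := by gcongr; exact norm_gridPoint_le k
      _ = 8 * d * (M * h) := by ring
      _ ≤ _ := by gcongr
  have h3 := norm_sub_norm_le y (h • gridPoint k)
  linarith

theorem ball_subset_ball_zero {h τ ρ : ℝ} (hh : 0 < h) (hM : M * h ≤ τ) (hρ : ρ ≤ 2 * τ)
    (k : Fin d → Fin M) :
    Metric.ball (h • gridPoint k) ρ ⊆ Metric.ball 0 (8 * d * τ + 2 * τ) := by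
  refine Metric.ball_subset_ball' ?_
  rw [dist_zero_right, norm_smul, Real.norm_of_nonneg hh.le]
  have : h * ‖gridPoint k‖ ≤ 8 * d * τ := by
    calc h * ‖gridPoint k‖ ≤ h * (8 * d * M) := by gcongr; exact norm_gridPoint_le k
      _ = 8 * d * (M * h) := by ring
      _ ≤ _ := by gcongr
  linarith

theorem exists_sobolevEnergy_gridBump_le {β : ℝ} (hβ : 0 < β) (hb : b.rOut = 1 / 2)
    (he : ‖e‖ = 1) : ∃ C : ℝ, 0 < C ∧ ∀ (M : ℕ) (h : ℝ) (ε : (Fin d → Fin M) → Bool), 0 < h →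
      sobolevEnergy β (gridBump b e h ε)
        ≤ ENNReal.ofReal (C * (M : ℝ) ^ d * h ^ ((d : ℝ) - 2 * β)) := by
  obtain ⟨C, hC, hbound⟩ := exists_sobolev_bound hβ (contDiff_oddBump (n := ⊤))
    (hasCompactSupport_oddBump hb he) (tsupport_oddBump_subset hb he)
  refine ⟨C, hC, fun M h ε hh => ?_⟩
  have := hbound (Fin d → Fin M) Finset.univ gridPoint (fun k => if ε k then 1 else 0) h hh
    (fun j _ k _ hjk => by linarith [le_dist_gridPoint hjk]) (fun k _ => by split_ifs <;> simp)
  simp only [Finset.card_univ, Fintype.card_fun, Fintype.card_fin, Nat.cast_pow] at this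
  exact this

end Grid

/-! ### The bound for one cell and the scaling of all quantities. -/

section LowerBound

variable {d : ℕ} {b : ContDiffBump (0 : EuclideanSpace ℝ (Fin d))} {e : EuclideanSpace ℝ (Fin d)}

theorem rpow_neg_half_eq {t : ℝ} (ht : 0 < t) (d : ℕ) : t ^ (-(d : ℝ) / 2) = (√t ^ d)⁻¹ := by
  rw [neg_div, Real.rpow_neg ht.le, ← Real.rpow_natCast, Real.sqrt_eq_rpow, ← Real.rpow_mul ht.le]
  congr 2
  ring

theorem integrable_oddBump_sq (hb : b.rOut = 1 / 2) (he : ‖e‖ = 1) :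
    Integrable fun y => oddBump b e y ^ 2 := by
  refine Continuous.integrable_of_hasCompactSupport (continuous_oddBump.pow 2) ?_
  exact (hasCompactSupport_oddBump hb he).comp_left (g := fun x : ℝ => x ^ 2) (by simp)

/-- No estimator is accurate near an odd bump for both of two densities which differ by this
bump, if the bump is too small to be detected from `n` observations. -/
theorem le_lintegral_localLoss_add {n : ℕ} (hn : n ≠ 0)
    {shat : (Fin n → EuclideanSpace ℝ (Fin d)) →
      EuclideanSpace ℝ (Fin d) → EuclideanSpace ℝ (Fin d)}
    (hs : Measurable (Function.uncurry shat)) {t h A U m : ℝ} (ht : 0 < t) (hh : 0 < h)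
    (hht : h ≤ √t) (hA : 0 ≤ A) (hU : 0 < U) (hm : 0 < m) (hb : b.rOut = 1 / 2) (he : ‖e‖ = 1)
    (z : EuclideanSpace ℝ (Fin d)) {p : EuclideanSpace ℝ (Fin d) → ℝ} (hpm : Measurable p)
    (hp : IsDensity p) (hq : IsDensity fun y => p y + A * oddBump b e (h⁻¹ • y - z))
    (hpU : ∀ x, diffusedDensity p t x ≤ U)
    (hqU : ∀ x, diffusedDensity (fun y => p y + A * oddBump b e (h⁻¹ • y - z)) t x ≤ U)
    (hpz : ∀ y ∈ Metric.ball (h • z) (h * (3 / 2)), m ≤ p y)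
    (hχ : A ^ 2 / m * (h ^ d * ∫ y, oddBump b e y ^ 2) ≤ (n : ℝ)⁻¹) :
    ENNReal.ofReal ((2 * (A * ((2 * Real.pi) ^ (-(d : ℝ) / 2) * Real.exp (-5) / 4 * (∫ y, b y) *
        (h / √t) ^ (d + 1))) / U) ^ 2 * ((√t / 4) ^ d *
        volume.real (Metric.ball (0 : EuclideanSpace ℝ (Fin d)) 1)) / (4 * t)) / 2 / 4 ≤
      ∫⁻ X, localLoss shat p t (Metric.ball (h • z) (3 * √t)) X
        ∂(Measure.pi fun _ : Fin n => densityMeasure p) +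
      ∫⁻ X, localLoss shat (fun y => p y + A * oddBump b e (h⁻¹ • y - z)) t
        (Metric.ball (h • z) (3 * √t)) X ∂(Measure.pi fun _ : Fin n =>
          densityMeasure fun y => p y + A * oddBump b e (h⁻¹ • y - z)) := by
  have hψc : Continuous fun y => oddBump b e (h⁻¹ • y - z) :=
    continuous_oddBump.comp (by fun_prop)
  obtain ⟨ρ, hρm, hρ, hρ2⟩ := exists_density_ratio hm hpm hp hq hψc.measurable
    (integrable_comp_inv_smul_sub integrable_oddBump hh z)
    (by rw [integral_comp_inv_smul_sub _ hh, integral_oddBump, mul_zero])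
    (integrable_comp_inv_smul_sub (integrable_oddBump_sq hb he) hh z)
    (fun y hy => hpz y (by
      rw [Metric.mem_ball, dist_eq_norm]
      exact norm_sub_lt_of_oddBump_ne_zero hb he hh hy))
  have := isProbabilityMeasure_densityMeasure hp
  have := isProbabilityMeasure_densityMeasure hq
  rw [integral_comp_inv_smul_sub (fun y => oddBump b e y ^ 2) hh z] at hρ2
  have hn' : (0 : ℝ) < n := by positivity
  have hρ2' : ∫⁻ x, ρ x ^ 2 ∂(densityMeasure p) ≤ 1 + (n : ENNReal)⁻¹ := by
    refine hρ2.trans ?_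
    gcongr
    calc _ ≤ ENNReal.ofReal (n : ℝ)⁻¹ := ENNReal.ofReal_le_ofReal hχ
      _ = _ := by rw [ENNReal.ofReal_inv_of_pos hn', ENNReal.ofReal_natCast]
  have hsep := le_lintegral_score_sub ht hh hht hA hU hb he z hp hq (fun y => rfl) hpU hqU
  have hloss := measurable_localLoss hs ht hp (Metric.ball (h • z) (3 * √t))
  have hloss' := measurable_localLoss hs ht hq (Metric.ball (h • z) (3 * √t))
  rw [hρ] at this ⊢
  refine le_lintegral_add_lintegral hn (densityMeasure p) hρm hρ2' hloss hloss' fun X => ?_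
  exact (ENNReal.div_le_div_right hsep 2).trans
    (lintegral_score_sub_le_localLoss hs ht hp _ X)

/-- For `t ≤ T` the factor is `1` and the sup bound on `p` is enough. For `t > T` the decay comes
from the height of the kernel. -/
theorem diffusedDensity_le_mul_pow {γ c C T t : ℝ} (hc : 0 < c) (hC : 0 < C)
    (ht : 0 < t) (hT : 0 < T) {p : EuclideanSpace ℝ (Fin d) → ℝ} (hp : p ∈ expTailClass d γ c C)
    (x : EuclideanSpace ℝ (Fin d)) :
    diffusedDensity p t x ≤
      (C + (2 * Real.pi * T) ^ (-(d : ℝ) / 2)) * (√(min t T) / √t) ^ d := by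
  have hst : 0 < √t := Real.sqrt_pos.2 ht
  have hsT : 0 < √T := Real.sqrt_pos.2 hT
  rcases le_total t T with h | h
  · rw [min_eq_left h, div_self hst.ne', one_pow, mul_one]
    have h1 : ∀ y, p y ≤ C := fun y => (hp.2 y).trans (mul_le_of_le_one_right hC.le
      (Real.exp_le_one_iff.2 (by
        have : 0 ≤ ‖y‖ ^ γ := by positivity
        nlinarith)))
    have h2 : 0 ≤ (2 * Real.pi * T) ^ (-(d : ℝ) / 2) := by positivity
    linarith [diffusedDensity_le_of_le ht hp.1.1 h1 x]
  · rw [min_eq_right h]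
    refine (diffusedDensity_le ht hp.1 x).trans ?_
    calc (2 * Real.pi * t) ^ (-(d : ℝ) / 2)
        = (2 * Real.pi * T) ^ (-(d : ℝ) / 2) * (√T / √t) ^ d := by
          rw [Real.mul_rpow (by positivity) ht.le, Real.mul_rpow (by positivity) hT.le,
            rpow_neg_half_eq ht, rpow_neg_half_eq hT, div_pow]
          field_simp
      _ ≤ _ := by
          gcongr
          linarith

/-- The clause `M = 1` is for `t ≥ T`, where `h = τ` and regions of radius `3√t` around several grid
points could overlap. -/
theorem exists_grid_size {h τ : ℝ} (hh : 0 < h) (hτ : h ≤ τ) :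
    ∃ M : ℕ, M * h ≤ τ ∧ τ / (2 * h) ≤ M ∧ (h = τ → M = 1) := by
  have h1 : 1 ≤ τ / h := (one_le_div hh).2 hτ
  refine ⟨⌊τ / h⌋₊, ?_, ?_, ?_⟩
  · rw [← le_div_iff₀ hh]
    exact Nat.floor_le (by positivity)
  · have h2 := Nat.lt_floor_add_one (τ / h)
    have h3 : (1 : ℝ) ≤ ⌊τ / h⌋₊ := by exact_mod_cast (Nat.one_le_floor_iff _).2 h1
    have h4 : τ / (2 * h) = τ / h / 2 := by field_simp
    rw [h4]
    linarith
  · rintro rfl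
    rw [div_self hh.ne', Nat.floor_one]

/-- With `s = d + 2β` and `h = √(min t T)`, the lower bound on `t` becomes `n⁻¹ h^(-d-2β) ≤ H`, the
quantity governing both the Sobolev energy and the height of the perturbation. -/
theorem inv_rpow_le_mul_nat {n : ℕ} (hn : n ≠ 0) {a T t s : ℝ} (ha : 0 < a) (hT : 0 < T)
    (hs : 0 < s) (ht : a * (n : ℝ) ^ (-2 / s) ≤ t) :
    √(min t T) ^ (-s) ≤ (min a T) ^ (-s / 2) * n := by
  have hn1 : (1 : ℝ) ≤ n := by exact_mod_cast Nat.one_le_iff_ne_zero.2 hn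
  have hn0 : (0 : ℝ) < n := by linarith
  have haT : 0 < min a T := lt_min ha hT
  have h1 : (n : ℝ) ^ (-2 / s) ≤ 1 := Real.rpow_le_one_of_one_le_of_nonpos hn1 (by
    rw [neg_div]
    exact neg_nonpos.2 (by positivity))
  have hpos : 0 < (n : ℝ) ^ (-2 / s) := by positivity
  have h2 : min a T * (n : ℝ) ^ (-2 / s) ≤ min t T := by
    refine le_min (le_trans ?_ ht) ?_
    · gcongr
      exact min_le_left _ _
    · calc _ ≤ min a T * 1 := by gcongr
        _ ≤ T := by rw [mul_one]; exact min_le_right _ _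
  have h3 : 0 < min t T := lt_of_lt_of_le (by positivity) h2
  rw [Real.sqrt_eq_rpow, ← Real.rpow_mul h3.le]
  calc (min t T) ^ (1 / 2 * -s) ≤ (min a T * (n : ℝ) ^ (-2 / s)) ^ (1 / 2 * -s) :=
        Real.rpow_le_rpow_of_nonpos (by positivity) h2 (by linarith)
    _ = _ := by
        rw [Real.mul_rpow haT.le (by positivity), ← Real.rpow_mul hn0.le,
          show -2 / s * (1 / 2 * -s) = 1 by field_simp, Real.rpow_one]
        congr 2
        ring

/-- The factor `(h / √t)^d` in the smoothed bump cancels against the same factor in the upper bound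
for `p_t`, so the log-ratio loses only one power of `h / √t`. -/
theorem weight_mul_separation_eq {t h A c CU m V : ℝ} (ht : 0 < t) (hh : 0 < h) (hCU : 0 < CU)
    (d : ℕ) :
    m * (h ^ d * V) * ((2 * Real.pi * t) ^ (-(d : ℝ) / 2) * Real.exp (-8)) *
      ((2 * (A * (c * (h / √t) ^ (d + 1))) / (CU * (h / √t) ^ d)) ^ 2 * ((√t / 4) ^ d * V) / (4 * t))
    = m * V ^ 2 * (2 * Real.pi) ^ (-(d : ℝ) / 2) * Real.exp (-8) * (2 * c / CU) ^ 2 / (4 * 4 ^ d) *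
      (A ^ 2 * h ^ (d + 2) / t ^ 2) := by
  rw [Real.mul_rpow (by positivity) ht.le, rpow_neg_half_eq ht]
  have hst : 0 < √t := Real.sqrt_pos.2 ht
  set s := √t with hs
  have hts : t = s ^ 2 := (Real.sq_sqrt ht.le).symm
  rw [hts]
  simp only [pow_succ, div_pow]
  field_simp

/-- The left side is the right side at `h = √t`. For `d ≥ 2` the power `h^(2-d)` does not increase
with `h`, so `h ≤ √t` suffices. For `d = 1` it increases, hence the restriction to `t ≤ T`. -/
theorem rpow_le_sq_div_pow {t h : ℝ} (ht : 0 < t) (hh : 0 < h) (hht : h ≤ √t) (hd : 1 ≤ d)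
    (h1 : d = 1 → h = √t) : t ^ (-1 - (d : ℝ) / 2) ≤ h ^ 2 / h ^ d / t ^ 2 := by
  have hst : 0 < √t := Real.sqrt_pos.2 ht
  have e1 : t ^ (-1 - (d : ℝ) / 2) = √t ^ 2 / √t ^ d / t ^ 2 := by
    rw [sub_eq_add_neg, Real.rpow_add ht, ← neg_div, rpow_neg_half_eq ht, Real.sq_sqrt ht.le,
      Real.rpow_neg_one]
    field_simp
  rw [e1]
  rcases hd.eq_or_lt with h2 | h2
  · rw [h1 h2.symm]
  · obtain ⟨k, rfl⟩ := Nat.exists_eq_add_of_le (show 2 ≤ d from h2)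
    have e2 : ∀ x : ℝ, 0 < x → x ^ 2 / x ^ (2 + k) = (x ^ k)⁻¹ := fun x hx => by
      rw [pow_add]; field_simp
    rw [e2 _ hst, e2 _ hh]
    gcongr

end LowerBound

/-! ### Assembling the minimax lower bound. -/

section Minimax

variable {d : ℕ}

theorem le_card_mul_of_rate {n t h τ cA c₃ A w Δ M : ℝ} (hn : 0 < n) (ht : 0 < t) (hh : 0 < h)
    (hτ : 0 < τ) (hcA : 0 < cA) (hc₃ : 0 ≤ c₃) (hM : τ / (2 * h) ≤ M)
    (hA : A ^ 2 = cA / (n * h ^ d)) (hwΔ : w * Δ = c₃ * (A ^ 2 * h ^ (d + 2) / t ^ 2))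
    (hrate : t ^ (-1 - (d : ℝ) / 2) ≤ h ^ 2 / h ^ d / t ^ 2) :
    2 * (c₃ * cA * τ ^ d / (2 ^ d * 16) * n⁻¹ * t ^ (-1 - (d : ℝ) / 2))
      ≤ M ^ d * (w * (Δ / 8)) := by
  calc 2 * (c₃ * cA * τ ^ d / (2 ^ d * 16) * n⁻¹ * t ^ (-1 - (d : ℝ) / 2))
      ≤ 2 * (c₃ * cA * τ ^ d / (2 ^ d * 16) * n⁻¹ * (h ^ 2 / h ^ d / t ^ 2)) := by gcongr
    _ = (τ / (2 * h)) ^ d * (c₃ * (A ^ 2 * h ^ (d + 2) / t ^ 2) / 8) := by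
        rw [hA, div_pow, mul_pow, pow_add]
        field_simp
        ring
    _ ≤ M ^ d * (c₃ * (A ^ 2 * h ^ (d + 2) / t ^ 2) / 8) := by gcongr
    _ = _ := by rw [← hwΔ]; ring

set_option maxHeartbeats 800000 in
/-- The minimax lower bound, from a base density which is bounded below on a ball. -/
theorem exists_le_minimaxScoreRisk {γ β L c C C' L' m a T : ℝ} (hd : 1 ≤ d) (hγ : 0 < γ)
    (hc : 0 < c) (hβ : 0 < β) (hC' : 0 < C') (hCC : C' < C) (hL' : 0 < L') (hLL : L' < L)
    (hm : 0 < m) (ha : 0 < a) (hT : 0 < T) {p : EuclideanSpace ℝ (Fin d) → ℝ}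
    (hpm : Measurable p) (hp : p ∈ expTailClass d γ c C' ∩ sobolevClass d β L')
    (hpR : ∀ x ∈ Metric.ball (0 : EuclideanSpace ℝ (Fin d)) (8 * d * √T + 2 * √T), m ≤ p x) :
    ∃ κ : ℝ, 0 < κ ∧ ∀ n : ℕ, n ≠ 0 → ∀ t : ℝ,
      a * (n : ℝ) ^ (-2 / ((d : ℝ) + 2 * β)) ≤ t → (d = 1 → t ≤ T) →
      ENNReal.ofReal (κ * (n : ℝ)⁻¹ * t ^ (-1 - (d : ℝ) / 2)) ≤
        minimaxScoreRisk (expTailClass d γ c C ∩ sobolevClass d β L) n t := by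
  let b : ContDiffBump (0 : EuclideanSpace ℝ (Fin d)) := ⟨1 / 4, 1 / 2, by norm_num, by norm_num⟩
  have hb : b.rOut = 1 / 2 := rfl
  let e : EuclideanSpace ℝ (Fin d) := EuclideanSpace.single ⟨0, hd⟩ 1
  have he : ‖e‖ = 1 := by simp [e]
  obtain ⟨A₀, κ₀, hA₀, hκ₀, hpert⟩ := exists_perturbation_mem hγ hc hCC hL' hLL hm hp hpR
  obtain ⟨CS, hCS, hSob⟩ := exists_sobolevEnergy_gridBump_le hβ hb he
  set τ := √T with hτ
  have hτ0 : 0 < τ := Real.sqrt_pos.2 hT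
  have hdβ : 0 < (d : ℝ) + 2 * β := by positivity
  set H := (min a T) ^ (-((d : ℝ) + 2 * β) / 2) with hH
  have hH0 : 0 < H := by
    have := lt_min ha hT
    positivity
  set K₂ := ∫ y, oddBump b e y ^ 2 with hK₂
  have hK₂0 : 0 ≤ K₂ := integral_nonneg fun y => sq_nonneg _
  -- With `A² = cA / (n h^d)`, the three conditions keep, in order, the chi-square divergence below
  -- `1/n`, the Sobolev energy below `κ₀`, and the height `A` below `A₀`.
  obtain ⟨cA, hcA, hcA1, hcA2, hcA3⟩ : ∃ cA : ℝ, 0 < cA ∧ cA * K₂ ≤ m / 2 ∧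
      cA * (CS * τ ^ d * H) ≤ κ₀ ∧ cA * (τ ^ (2 * β) * H) ≤ A₀ ^ 2 := by
    set x₁ := m / 2 / (K₂ + 1) with hx₁
    set x₂ := κ₀ / (CS * τ ^ d * H) with hx₂
    set x₃ := A₀ ^ 2 / (τ ^ (2 * β) * H) with hx₃
    have h1 : min x₁ (min x₂ x₃) ≤ x₁ := min_le_left _ _
    have h2 : min x₁ (min x₂ x₃) ≤ x₂ := (min_le_right _ _).trans (min_le_left _ _)
    have h3 : min x₁ (min x₂ x₃) ≤ x₃ := (min_le_right _ _).trans (min_le_right _ _)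
    refine ⟨min x₁ (min x₂ x₃), by positivity, ?_, ?_, ?_⟩
    · calc _ ≤ x₁ * (K₂ + 1) := by gcongr; linarith
        _ = _ := by rw [hx₁]; field_simp
    · rwa [hx₂, le_div_iff₀ (by positivity)] at h2
    · rwa [hx₃, le_div_iff₀ (by positivity)] at h3
  set V := volume.real (Metric.ball (0 : EuclideanSpace ℝ (Fin d)) 1) with hV
  have hV0 : 0 < V := ENNReal.toReal_pos (Metric.measure_ball_pos _ _ one_pos).ne'
    measure_ball_lt_top.ne
  set c₁ := (2 * Real.pi) ^ (-(d : ℝ) / 2) * Real.exp (-5) / 4 * (∫ y, b y) with hc₁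
  have hc₁0 : 0 < c₁ := by
    have := b.integral_pos (μ := volume)
    positivity
  set CU := C + (2 * Real.pi * T) ^ (-(d : ℝ) / 2) with hCU
  have hC : 0 < C := hC'.trans hCC
  have hCU0 : 0 < CU := by positivity
  set c₃ := m / 2 * V ^ 2 * (2 * Real.pi) ^ (-(d : ℝ) / 2) * Real.exp (-8) *
    (2 * c₁ / CU) ^ 2 / (4 * 4 ^ d) with hc₃
  have hc₃0 : 0 < c₃ := by positivity
  -- `2^d` comes from `M ≥ τ / (2h)`. The factor `16` collects `2` from the triangle inequality, `4`
  -- from the two-point bound and `2` from Assouad's lemma.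
  refine ⟨c₃ * cA * τ ^ d / (2 ^ d * 16), by positivity, fun n hn t hat htT => ?_⟩
  have hn0 : (0 : ℝ) < n := by positivity
  have ht : 0 < t := lt_of_lt_of_le (by positivity) hat
  have hst : 0 < √t := Real.sqrt_pos.2 ht
  set h := √(min t T) with hh
  have hh0 : 0 < h := Real.sqrt_pos.2 (lt_min ht hT)
  have hht : h ≤ √t := Real.sqrt_le_sqrt (min_le_left _ _)
  have hhτ : h ≤ τ := Real.sqrt_le_sqrt (min_le_right _ _)
  have hhn : h ^ (-((d : ℝ) + 2 * β)) ≤ H * n := inv_rpow_le_mul_nat hn ha hT hdβ hat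
  obtain ⟨M, hM, hM', hM1⟩ := exists_grid_size hh0 hhτ
  set A := √(cA / (n * h ^ d)) with hA
  have hA0 : 0 ≤ A := Real.sqrt_nonneg _
  have hA2 : A ^ 2 = cA / (n * h ^ d) := Real.sq_sqrt (by positivity)
  have hrpow : h ^ (-((d : ℝ) + 2 * β)) = (h ^ d)⁻¹ * (h ^ (2 * β))⁻¹ := by
    rw [neg_add, Real.rpow_add hh0, Real.rpow_neg hh0.le, Real.rpow_neg hh0.le, Real.rpow_natCast]
  have hinv : (n : ℝ)⁻¹ * ((h ^ d)⁻¹ * (h ^ (2 * β))⁻¹) ≤ H := by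
    rw [← hrpow, inv_mul_le_iff₀ hn0, mul_comm (n : ℝ)]
    exact hhn
  have hAA₀ : A ≤ A₀ := by
    refine le_of_sq_le_sq ?_ hA₀.le
    rw [hA2]
    calc cA / (n * h ^ d)
        = cA * (h ^ (2 * β) * ((n : ℝ)⁻¹ * ((h ^ d)⁻¹ * (h ^ (2 * β))⁻¹))) := by field_simp
      _ ≤ cA * (τ ^ (2 * β) * H) := by gcongr
      _ ≤ A₀ ^ 2 := hcA3
  let q : ((Fin d → Fin M) → Bool) → EuclideanSpace ℝ (Fin d) → ℝ :=
    fun ε x => p x + A * gridBump b e h ε x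
  have hq : ∀ ε, q ε ∈ expTailClass d γ c C ∩ sobolevClass d β L ∧
      ∀ x ∈ Metric.ball (0 : EuclideanSpace ℝ (Fin d)) (8 * d * τ + 2 * τ), m / 2 ≤ q ε x := by
    intro ε
    refine hpert _ A hA0 hAA₀ (integrable_gridBump hh0 ε) (integral_gridBump hh0 ε)
      (abs_gridBump_le hb he h ε) (fun x hx => gridBump_eq_zero hb he hh0 hhτ hM ε hx) ?_
    calc ENNReal.ofReal (A ^ 2) * sobolevEnergy β (gridBump b e h ε)
        ≤ ENNReal.ofReal (A ^ 2) * ENNReal.ofReal (CS * (M : ℝ) ^ d * h ^ ((d : ℝ) - 2 * β)) := by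
          gcongr
          exact hSob M h ε hh0
      _ = ENNReal.ofReal (A ^ 2 * (CS * (M : ℝ) ^ d * h ^ ((d : ℝ) - 2 * β))) :=
          (ENNReal.ofReal_mul (sq_nonneg A)).symm
      _ ≤ _ := by
          refine ENNReal.ofReal_le_ofReal (le_trans (le_of_eq ?_) (le_trans (b :=
            cA * (CS * (M * h) ^ d * ((n : ℝ)⁻¹ * ((h ^ d)⁻¹ * (h ^ (2 * β))⁻¹)))) le_rfl
            (le_trans ?_ hcA2)))
          · rw [hA2, Real.rpow_sub hh0, Real.rpow_natCast, mul_pow]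
            field_simp
          · gcongr
  have hqm : ∀ ε, Measurable (q ε) := fun ε =>
    hpm.add ((continuous_gridBump h ε).measurable.const_mul A)
  have hqd : ∀ ε, IsDensity (q ε) := fun ε => (hq ε).1.1.1
  have hqU : ∀ ε x, diffusedDensity (q ε) t x ≤ CU * (h / √t) ^ d := fun ε x =>
    diffusedDensity_le_mul_pow hc hC ht hT (hq ε).1.1 x
  have hupd : ∀ (ε : (Fin d → Fin M) → Bool) (k : Fin d → Fin M), ε k = false →
      q (Function.update ε k true) = fun y => q ε y + A * oddBump b e (h⁻¹ • y - gridPoint k) := by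
    intro ε k hk
    ext y
    simp only [q]
    rw [gridBump_update h hk]
    ring
  let S : (Fin d → Fin M) → Set (EuclideanSpace ℝ (Fin d)) :=
    fun k => Metric.ball (h • gridPoint k) (3 * √t)
  have hSd : Pairwise (Function.onFun Disjoint S) := by
    intro j k hjk
    refine Metric.ball_disjoint_ball ?_
    rcases le_total t T with htT' | htT'
    · have h1 : h = √t := by rw [hh, min_eq_left htT']
      rw [dist_smul₀, Real.norm_of_nonneg hh0.le, ← h1]
      nlinarith [le_dist_gridPoint hjk]
    · have h1 : M = 1 := hM1 (by rw [hh, min_eq_right htT'])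
      subst h1
      exact absurd (Subsingleton.elim j k) hjk
  set w := m / 2 * (h ^ d * V) * ((2 * Real.pi * t) ^ (-(d : ℝ) / 2) * Real.exp (-8)) with hw
  have hw0 : 0 < w := by positivity
  have hqw : ∀ ε k, ∀ x ∈ S k, w ≤ diffusedDensity (q ε) t x := by
    intro ε k x hx
    exact le_diffusedDensity ht hh0 hht (half_pos hm).le (hqd ε)
      (fun y hy => (hq ε).2 y (ball_subset_ball_zero hh0 hM (by linarith) k hy))
      (Metric.mem_ball.1 hx).le
  set Δ := (2 * (A * (c₁ * (h / √t) ^ (d + 1))) / (CU * (h / √t) ^ d)) ^ 2 *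
    ((√t / 4) ^ d * V) / (4 * t) with hΔ
  have hχ : A ^ 2 / (m / 2) * (h ^ d * K₂) ≤ (n : ℝ)⁻¹ := by
    calc A ^ 2 / (m / 2) * (h ^ d * K₂) = cA * K₂ / (m / 2) * (n : ℝ)⁻¹ := by
          rw [hA2]; field_simp
      _ ≤ 1 * (n : ℝ)⁻¹ := by
          gcongr
          exact div_le_one_of_le₀ hcA1 (by positivity)
      _ = _ := one_mul _
  refine le_iInf₂ fun shat hs => ?_
  have hmain := card_mul_le_two_mul_of_pairs
    (R := fun ε => scoreRisk shat (q ε) t)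
    (a := fun ε k => ENNReal.ofReal w * ∫⁻ X, localLoss shat (q ε) t (S k) X
        ∂(Measure.pi fun _ : Fin n => densityMeasure (q ε)))
    (D := ENNReal.ofReal w * (ENNReal.ofReal Δ / 2 / 4))
    (M := ⨆ p ∈ expTailClass d γ c C ∩ sobolevClass d β L, scoreRisk shat p t)
    (fun ε => sum_localLoss_le_scoreRisk hs ht (hqd ε) (fun k => measurableSet_ball) hSd (hqw ε))
    (fun ε k hk => by
      rw [← mul_add]
      gcongr
      have hqd' := hqd (Function.update ε k true)
      have hqU' := hqU (Function.update ε k true)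
      rw [hupd ε k hk] at hqd' hqU' ⊢
      exact le_lintegral_localLoss_add hn hs ht hh0 hht hA0 (by positivity) (half_pos hm) hb he
        (gridPoint k) (hqm ε) (hqd ε) hqd' (hqU ε) hqU'
        (fun y hy => (hq ε).2 y (ball_subset_ball_zero hh0 hM (by linarith) k hy)) hχ)
    (fun ε => le_iSup₂ (f := fun p _ => scoreRisk shat p t) (q ε) (hq ε).1)
  refine (ENNReal.mul_le_mul_iff_right (a := 2) (by norm_num) (by norm_num)).1
    (le_trans ?_ hmain)
  have hcard : ((Fintype.card (Fin d → Fin M) : ℕ) : ENNReal) = ENNReal.ofReal ((M : ℝ) ^ d) := by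
    rw [Fintype.card_fun, Fintype.card_fin, Fintype.card_fin, ← Nat.cast_pow,
      ENNReal.ofReal_natCast]
  have hD : ENNReal.ofReal Δ / 2 / 4 = ENNReal.ofReal (Δ / 8) := by
    rw [← ENNReal.ofReal_ofNat 2, ← ENNReal.ofReal_ofNat 4,
      ← ENNReal.ofReal_div_of_pos (by norm_num), ← ENNReal.ofReal_div_of_pos (by norm_num)]
    congr 1
    ring
  rw [hcard, hD, ← ENNReal.ofReal_mul hw0.le, ← ENNReal.ofReal_mul (by positivity),
    ← ENNReal.ofReal_ofNat 2, ← ENNReal.ofReal_mul (by norm_num)]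
  refine ENNReal.ofReal_le_ofReal ?_
  exact le_card_mul_of_rate hn0 ht hh0 hτ0 hcA hc₃0.le hM' hA2
    (weight_mul_separation_eq ht hh0 hCU0 d)
    (rpow_le_sq_div_pow ht hh0 hht hd fun h1 => by rw [hh, min_eq_left (htT h1)])

end Minimax

end ScoreEstimation

end

theorem theorem10 (d : ℕ) (hd : 1 ≤ d) (γ β L c₁ : ℝ) (hγ : 0 < γ) (hβ : 0 < β) (hL : 0 < L)
    (hc₁ : 0 < c₁) :
    (∀ C₁ : ℝ, ScoreEstimation.Nondegenerate d γ c₁ C₁ β L →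
      ∀ a T : ℝ, 0 < a → 0 < T →
        ∃ κ : ℝ, 0 < κ ∧ ∃ N : ℕ, ∀ n : ℕ, N ≤ n → ∀ t : ℝ,
          a * (n : ℝ) ^ (-2 / ((d : ℝ) + 2 * β)) ≤ t → (d = 1 → t ≤ T) →
          ENNReal.ofReal (κ * (n : ℝ)⁻¹ * t ^ (-1 - (d : ℝ) / 2)) ≤
            ScoreEstimation.minimaxScoreRisk
              (ScoreEstimation.expTailClass d γ c₁ C₁ ∩ ScoreEstimation.sobolevClass d β L) n t) ∧
    (∃ C₀ : ℝ, ∀ C₁ : ℝ, C₀ ≤ C₁ → ScoreEstimation.Nondegenerate d γ c₁ C₁ β L) := by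
  refine ⟨fun C₁ hnd a T ha hT => ?_, ScoreEstimation.exists_nondegenerate d hγ hc₁ hβ hL⟩
  -- The scaled grid lies within `8 d √T` of the origin, and the extra `2√T` covers the supports of
  -- the bumps, of radius `3h/2`.
  have hR : 0 < 8 * d * √T + 2 * √T := by
    have := Real.sqrt_pos.2 hT
    positivity
  obtain ⟨C', L', m, hC', hCC, hL', hLL, hm, p, hpm, hp, hpR⟩ := hnd.exists_base hγ hc₁ hβ hR
  obtain ⟨κ, hκ, h⟩ := ScoreEstimation.exists_le_minimaxScoreRisk hd hγ hc₁ hβ hC' hCC hL' hLL hm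
    ha hT hpm hp hpR
  exact ⟨κ, hκ, 1, fun n hn t => h n (Nat.one_le_iff_ne_zero.1 hn) t⟩
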